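/- For integers $n\ge 1$ and $k\ge 0$, let $c(n,k)$ be the least nonnegative integer $N$ such that for all $m$, $A\in\mathbb{R}^{m\times n}$ and $b\in\mathbb{R}^m$ for which $\{x\in\mathbb{R}^n : Ax\le b\}$ contains exactly $k$ integer points, there is a set $I$ of at most $N$ rows of $A$ such that $\{x\in\mathbb{R}^n : A_I x\le b_I\}$ contains exactly the same $k$ integer points. A set of points is in convex position if none of its points is a convex combination of the others. Let $\ell(n,k)$ be the least nonnegative integer $N$ such that every set $V\subseteq\mathbb{Z}^n$ in convex position with $|V|=N$ satisfies $|(\operatorname{conv}(V)\cap\mathbb{Z}^n)\setminus V|\ge k$. Theorem. For every integer $k\ge 0$, the numbers $c(2,k)$ and $\ell(2,k+1)$ exist, and $$c(2,k)\;\le\;\ell(2,k+1)-1\;\le\;\bigl\lfloor 4.43\,(k+4)^{1/3}\bigr\rfloor .$$ -/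

import Mathlib

namespace QuantDoignon

/-- The inclusion of `ℤⁿ` into `ℝⁿ`. -/
def toReal {n : ℕ} (x : Fin n → ℤ) : Fin n → ℝ := fun i => (x i : ℝ)

/-- The integer points of the polyhedron `{x ∈ ℝⁿ | A x ≤ b}`. -/
def integerPoints {n : ℕ} {ι : Type*} (A : Matrix ι (Fin n) ℝ) (b : ι → ℝ) :
    Set (Fin n → ℤ) :=
  {x | A.mulVec (toReal x) ≤ b}

/-- The set of those `N` such that every system `A x ≤ b` in `ℝⁿ` with exactly `k` integer
solutions has a subsystem, given by a set `I` of at most `N` rows, with exactly the same integer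
solutions. The cardinality is taken in `ℕ∞`, so an infinite solution set never has `k` elements. -/
def helBounds (n k : ℕ) : Set ℕ :=
  {N | ∀ (m : ℕ) (A : Matrix (Fin m) (Fin n) ℝ) (b : Fin m → ℝ),
    (integerPoints A b).encard = (k : ℕ∞) →
      ∃ I : Finset (Fin m), I.card ≤ N ∧
        integerPoints (A.submatrix (fun i : I => (i : Fin m)) id) (fun i : I => b i) =
          integerPoints A b}

/-- The quantitative Doignon number `c(n, k)`. -/
noncomputable def c (n k : ℕ) : ℕ := sInf (helBounds n k)

/-- A finite set of integer points is in convex position: none of its points is a convex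
combination of the others. -/
def InConvexPosition {n : ℕ} (V : Finset (Fin n → ℤ)) : Prop :=
  ConvexIndependent ℝ (fun v : V => toReal (v : Fin n → ℤ))

/-- The integer points of the convex hull of `V`. -/
def iconv {n : ℕ} (V : Finset (Fin n → ℤ)) : Set (Fin n → ℤ) :=
  {x | toReal x ∈ convexHull ℝ (toReal '' (V : Set (Fin n → ℤ)))}

/-- The set of those `N` such that every set `V` of exactly `N` integer points in convex position
has at least `k` integer points in its convex hull that do not belong to `V`. -/
def ellBounds (n k : ℕ) : Set ℕ :=
  {N | ∀ V : Finset (Fin n → ℤ), InConvexPosition V → V.card = N →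
    (k : ℕ∞) ≤ (iconv V \ (V : Set (Fin n → ℤ))).encard}

/-- The number `ℓ(n, k)`. -/
noncomputable def ell (n k : ℕ) : ℕ := sInf (ellBounds n k)

end QuantDoignon

/-!
The inequality `c(n, k) ≤ ℓ(n, k + 1) - 1` is a relaxation argument. In an irredundant system with
`k` integer solutions, the right-hand sides are increased one after the other, as far as the strict
inequalities have no new solution within a finite set of lattice points. Then every relaxed
inequality is tight at a lattice point that satisfies all the others strictly
(`exists_relaxation`). Such points are in convex position, and any other lattice point of their
convex hull satisfies all relaxed inequalities strictly, so that it is one of the `k` solutions;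
hence there are fewer than `ℓ(n, k + 1)` inequalities (`sub_one_mem_helBounds`).

For the bound on `ℓ(2, k + 1)`, consider `n` lattice points in convex position. The polygon `P` that
they span has few lattice points only if it has small area, by Pick's inequality
(`exists_lattice_points_fan`), and its area is at least `n ^ 3 / (8 π ^ 2)`
(`card_pow_three_le_area`), because consecutive edges have determinant at least `1`. This is an
affine isoperimetric inequality: the midpoints of consecutive edges can be joined by arcs of
parabolas tangent to the edges there, which gives a convex curve inside `P` of affine length at
least `n`, and a closed convex curve of affine length `L` encloses an area of at least
`L ^ 3 / (8 π ^ 2)`, with equality for ellipses.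

The isoperimetric inequality is proved for the control polygons of chains of parabolas, so that
everything is polygonal. The curve is cut by two parallel tangents into two halves, and each half at
the point farthest from its chord; an affine map carries each of the four arcs to an arc in a
quadrant with a vertical tangent on one axis and a horizontal tangent on the other. For such an arc,
the arithmetic–geometric mean inequality (`three_mul_duration_le`) bounds the cube of the affine
length by `S ^ 2 * T`, where `S` is twice the area swept by the arc and `T` twice the area swept by
the polar arc, and `S * T ≤ π ^ 2 / 4` is the Blaschke–Santaló inequality in a quadrant
(`DualChains.fan_mul_fan_le`). Its proof is of Prékopa–Leindler type: if a point of the arc and a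
point of the polar arc move so that they sweep equal fractions of the two areas, their
coordinatewise geometric mean stays in the unit disc and sweeps an area of at least the geometric
mean of the two areas.
-/

namespace QuantDoignon

/-! ### A planar Blaschke–Santaló inequality for dual pairs of chains in a quadrant -/

/-- The determinant of two vectors of the plane. -/
def cross (a b : ℝ × ℝ) : ℝ := a.1 * b.2 - a.2 * b.1

/-- Twice the signed area swept from the origin along the polygonal line with vertices `p :: ps`. -/
def fan : ℝ × ℝ → List (ℝ × ℝ) → ℝ
  | _, [] => 0
  | p, p' :: ps => cross p p' + fan p' ps

lemma fan_nonneg : ∀ (ps : List (ℝ × ℝ)) (p : ℝ × ℝ),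
    (p :: ps).IsChain (fun a b => 0 < cross a b) → 0 ≤ fan p ps
  | [], _, _ => le_rfl
  | p' :: ps, p, h => by
    rw [List.isChain_cons_cons] at h
    have := fan_nonneg ps p' h.2
    simp only [fan]
    linarith [h.1]

lemma fan_pos {ps : List (ℝ × ℝ)} {p : ℝ × ℝ} (hne : ps ≠ [])
    (h : (p :: ps).IsChain (fun a b => 0 < cross a b)) : 0 < fan p ps := by
  cases ps with
  | nil => exact absurd rfl hne
  | cons p' ps =>
    rw [List.isChain_cons_cons] at h
    have := fan_nonneg ps p' h.2
    simp only [fan]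
    linarith [h.1]

lemma eq_mul_cos_arctan {a₁ a₂ : ℝ} (h : 0 < a₁) :
    a₁ = √(a₁ ^ 2 + a₂ ^ 2) * Real.cos (Real.arctan (a₂ / a₁)) ∧
      a₂ = √(a₁ ^ 2 + a₂ ^ 2) * Real.sin (Real.arctan (a₂ / a₁)) := by
  have h1 : √(1 + (a₂ / a₁) ^ 2) = √(a₁ ^ 2 + a₂ ^ 2) / a₁ := by
    rw [show 1 + (a₂ / a₁) ^ 2 = (a₁ ^ 2 + a₂ ^ 2) / a₁ ^ 2 by field_simp,
      Real.sqrt_div (by positivity), Real.sqrt_sq h.le]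
  have h2 : 0 < √(a₁ ^ 2 + a₂ ^ 2) := Real.sqrt_pos.2 (by positivity)
  rw [Real.cos_arctan, Real.sin_arctan, h1]
  constructor <;> field_simp

/-- The triangle spanned by two points of the unit disc is contained in the sector they span. -/
lemma cross_le_arctan_sub {a b : ℝ × ℝ} (ha : 0 < a.1) (hb : 0 < b.1)
    (ha' : a.1 ^ 2 + a.2 ^ 2 ≤ 1) (hb' : b.1 ^ 2 + b.2 ^ 2 ≤ 1) (h : 0 ≤ cross a b) :
    cross a b ≤ Real.arctan (b.2 / b.1) - Real.arctan (a.2 / a.1) := by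
  obtain ⟨e1, e2⟩ := eq_mul_cos_arctan (a₂ := a.2) ha
  obtain ⟨e3, e4⟩ := eq_mul_cos_arctan (a₂ := b.2) hb
  have hle : Real.arctan (a.2 / a.1) ≤ Real.arctan (b.2 / b.1) := by
    apply Real.arctan_mono
    rw [div_le_div_iff₀ ha hb]
    unfold cross at h
    linarith
  set α := Real.arctan (a.2 / a.1)
  set β := Real.arctan (b.2 / b.1)
  have hr : √(a.1 ^ 2 + a.2 ^ 2) ≤ 1 := Real.sqrt_le_one.2 ha'
  have hs : √(b.1 ^ 2 + b.2 ^ 2) ≤ 1 := Real.sqrt_le_one.2 hb'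
  have hc : cross a b = √(a.1 ^ 2 + a.2 ^ 2) * √(b.1 ^ 2 + b.2 ^ 2) * Real.sin (β - α) := by
    rw [Real.sin_sub]
    unfold cross
    calc a.1 * b.2 - a.2 * b.1 = (√(a.1 ^ 2 + a.2 ^ 2) * Real.cos α) *
          (√(b.1 ^ 2 + b.2 ^ 2) * Real.sin β) - (√(a.1 ^ 2 + a.2 ^ 2) * Real.sin α) *
          (√(b.1 ^ 2 + b.2 ^ 2) * Real.cos β) := by rw [← e1, ← e2, ← e3, ← e4]
      _ = _ := by ring
  rw [hc]
  have h1 : Real.sin (β - α) ≤ β - α := Real.sin_le (by linarith)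
  have h2 : √(a.1 ^ 2 + a.2 ^ 2) * √(b.1 ^ 2 + b.2 ^ 2) ≤ 1 :=
    mul_le_one₀ hr (Real.sqrt_nonneg _) hs
  calc _ ≤ √(a.1 ^ 2 + a.2 ^ 2) * √(b.1 ^ 2 + b.2 ^ 2) * (β - α) := by gcongr
    _ ≤ 1 * (β - α) := by
      gcongr
    _ = _ := one_mul _

lemma cross_le_pi_div_two_sub {a b : ℝ × ℝ} (ha : 0 < a.1) (hb : 0 ≤ b.1)
    (ha' : a.1 ^ 2 + a.2 ^ 2 ≤ 1) (hb' : b.1 ^ 2 + b.2 ^ 2 ≤ 1) (h : 0 ≤ cross a b) :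
    cross a b ≤ Real.pi / 2 - Real.arctan (a.2 / a.1) := by
  rcases hb.eq_or_lt with hb | hb
  · obtain ⟨e1, -⟩ := eq_mul_cos_arctan (a₂ := a.2) ha
    have h0 := Real.arctan_lt_pi_div_two (a.2 / a.1)
    set α := Real.arctan (a.2 / a.1)
    have hr : √(a.1 ^ 2 + a.2 ^ 2) ≤ 1 := Real.sqrt_le_one.2 ha'
    have h1 : Real.sin (Real.pi / 2 - α) ≤ Real.pi / 2 - α := Real.sin_le (by linarith)
    rw [Real.sin_pi_div_two_sub] at h1
    have h2 : 0 ≤ Real.cos α := Real.cos_arctan_pos _ |>.le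
    have hb2 : b.2 ≤ 1 := by nlinarith
    have h3 : a.1 ≤ Real.cos α := by
      calc a.1 = _ := e1
        _ ≤ 1 * Real.cos α := by gcongr
        _ = _ := one_mul _
    unfold cross
    rw [← hb]
    nlinarith
  · have := cross_le_arctan_sub ha hb ha' hb' h
    linarith [Real.arctan_lt_pi_div_two (b.2 / b.1)]

lemma sqrt_mul_sub_le {A B C D : ℝ} (hC : 0 ≤ C) (hD : 0 ≤ D) (hAC : C ≤ A) (hBD : D ≤ B) :
    √((A - C) * (B - D)) ≤ √(A * B) - √(C * D) := by
  have h : √((A - C) * (B - D)) + √(C * D) ≤ √(A * B) := by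
    apply Real.le_sqrt_of_sq_le
    rw [Real.sqrt_mul (by linarith), Real.sqrt_mul hC]
    have e1 := Real.sq_sqrt (show 0 ≤ A - C by linarith)
    have e2 := Real.sq_sqrt (show 0 ≤ B - D by linarith)
    have e3 := Real.sq_sqrt hC
    have e4 := Real.sq_sqrt hD
    set w := √(A - C)
    set x := √(B - D)
    set y := √C
    set z := √D
    have : A * B = (w ^ 2 + y ^ 2) * (x ^ 2 + z ^ 2) := by rw [e1, e2, e3, e4]; ring
    rw [this]
    nlinarith [sq_nonneg (w * z - y * x)]
  linarith

/-- The coordinatewise geometric mean of two points of the closed quadrant. -/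
noncomputable def geom (p q : ℝ × ℝ) : ℝ × ℝ := (√(p.1 * q.1), √(p.2 * q.2))

lemma geom_comm (p q : ℝ × ℝ) : geom p q = geom q p := by
  simp [geom, mul_comm]

lemma geom_sq_le {p q : ℝ × ℝ} (hp : 0 ≤ p) (hq : 0 ≤ q) (h : p.1 * q.1 + p.2 * q.2 ≤ 1) :
    (geom p q).1 ^ 2 + (geom p q).2 ^ 2 ≤ 1 := by
  simp only [geom]
  rw [Real.sq_sqrt (mul_nonneg hp.1 hq.1), Real.sq_sqrt (mul_nonneg hp.2 hq.2)]
  exact h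

/-- The Prékopa–Leindler step: passing to geometric means does not decrease the geometric mean
of the areas of two triangles. -/
lemma sqrt_cross_mul_cross_le {p q p' q' : ℝ × ℝ} (hp : 0 ≤ p) (hq : 0 ≤ q) (hp' : 0 ≤ p')
    (hq' : 0 ≤ q') (h : 0 ≤ cross p p') (h' : 0 ≤ cross q q') :
    √(cross p p' * cross q q') ≤ cross (geom p q) (geom p' q') := by
  have hp1 := hp.1
  have hp2 := hp.2
  have hq1 := hq.1
  have hq2 := hq.2
  have hp1' := hp'.1
  have hp2' := hp'.2
  have hq1' := hq'.1
  have hq2' := hq'.2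
  simp only [Prod.fst_zero, Prod.snd_zero] at *
  unfold cross at *
  refine (sqrt_mul_sub_le (mul_nonneg hp2 hp1') (mul_nonneg hq2 hq1')
    (by linarith) (by linarith)).trans_eq ?_
  simp only [geom]
  rw [← Real.sqrt_mul (mul_nonneg hp1 hq1), ← Real.sqrt_mul (mul_nonneg hp2 hq2)]
  congr 2 <;> ring

/-- `DualChains p ps q qs`: the polygonal lines `p :: ps` and `q :: qs` lie in the closed first
quadrant, turn strictly counterclockwise about the origin, start off the vertical axis, and every
vertex of one lies in the polar of the other. -/
structure DualChains (p : ℝ × ℝ) (ps : List (ℝ × ℝ)) (q : ℝ × ℝ) (qs : List (ℝ × ℝ)) : Prop where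
  chain_left : (p :: ps).IsChain (fun a b => 0 < cross a b)
  chain_right : (q :: qs).IsChain (fun a b => 0 < cross a b)
  nonneg_left : ∀ z ∈ p :: ps, 0 ≤ z
  nonneg_right : ∀ z ∈ q :: qs, 0 ≤ z
  pos_left : 0 < p.1
  pos_right : 0 < q.1
  polar : ∀ z ∈ p :: ps, ∀ w ∈ q :: qs, z.1 * w.1 + z.2 * w.2 ≤ 1

lemma DualChains.symm {p q : ℝ × ℝ} {ps qs : List (ℝ × ℝ)} (h : DualChains p ps q qs) :
    DualChains q qs p ps where
  chain_left := h.chain_right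
  chain_right := h.chain_left
  nonneg_left := h.nonneg_right
  nonneg_right := h.nonneg_left
  pos_left := h.pos_right
  pos_right := h.pos_left
  polar z hz w hw := by
    have := h.polar w hw z hz
    linarith

/-- The angle still available to a pair of dual points before the vertical axis is reached. -/
noncomputable def remainingAngle (p q : ℝ × ℝ) : ℝ :=
  Real.pi / 2 - Real.arctan ((geom p q).2 / (geom p q).1)

lemma remainingAngle_comm (p q : ℝ × ℝ) : remainingAngle p q = remainingAngle q p := by
  rw [remainingAngle, geom_comm, remainingAngle]

lemma remainingAngle_le (p q : ℝ × ℝ) :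
    remainingAngle p q ≤ Real.pi / 2 := by
  have : 0 ≤ Real.arctan ((geom p q).2 / (geom p q).1) := by
    apply Real.arctan_nonneg.2
    simp only [geom]
    positivity
  unfold remainingAngle
  linarith

lemma sqrt_le_remainingAngle_sub {p q p' q' : ℝ × ℝ} (hp : 0 ≤ p) (hq : 0 ≤ q) (hp' : 0 ≤ p')
    (hq' : 0 ≤ q') (h : 0 ≤ cross p p') (h' : 0 ≤ cross q q') (hp1 : 0 < p.1) (hq1 : 0 < q.1)
    (hp1' : 0 < p'.1) (hq1' : 0 < q'.1) (hpq : p.1 * q.1 + p.2 * q.2 ≤ 1)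
    (hpq' : p'.1 * q'.1 + p'.2 * q'.2 ≤ 1) :
    √(cross p p' * cross q q') ≤ remainingAngle p q - remainingAngle p' q' := by
  have h1 := sqrt_cross_mul_cross_le hp hq hp' hq' h h'
  have h2 := cross_le_arctan_sub (a := geom p q) (b := geom p' q')
    (Real.sqrt_pos.2 (mul_pos hp1 hq1)) (Real.sqrt_pos.2 (mul_pos hp1' hq1'))
    (geom_sq_le hp hq hpq) (geom_sq_le hp' hq' hpq') ((Real.sqrt_nonneg _).trans h1)
  unfold remainingAngle
  linarith

lemma fst_pos_of_cross_pos {p p' : ℝ × ℝ} (hp : 0 ≤ p) (hp' : 0 ≤ p') (h : 0 < cross p p') :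
    0 < p.1 := by
  have h1 := hp.1
  have h2 := hp.2
  have h3 := hp'.1
  have h4 := hp'.2
  simp only [Prod.fst_zero, Prod.snd_zero] at *
  unfold cross at h
  by_contra hc
  have : p.1 = 0 := by linarith
  rw [this] at h
  nlinarith [mul_nonneg h2 h3]

lemma chain_fst_pos {p : ℝ × ℝ} {ps : List (ℝ × ℝ)} (hne : ps ≠ [])
    (h : (p :: ps).IsChain (fun a b => 0 < cross a b)) (h0 : ∀ z ∈ p :: ps, 0 ≤ z) :
    0 < p.1 := by
  cases ps with
  | nil => exact absurd rfl hne
  | cons p' ps =>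
    rw [List.isChain_cons_cons] at h
    exact fst_pos_of_cross_pos (h0 _ (by simp)) (h0 _ (by simp)) h.1

/-- If the two chains are run through so that equal fractions of their areas are swept at the same
time, every step costs the angle between consecutive geometric means; here the first segment of
the left chain is used up before the first segment of the right chain is. -/
lemma DualChains.sqrt_le_of_lt {p p' q q' : ℝ × ℝ} {ps qs : List (ℝ × ℝ)}
    (H : DualChains p (p' :: ps) q (q' :: qs))
    (ih : ∀ q'', DualChains p' ps q'' (q' :: qs) → ps ≠ [] →
      √(fan p' ps * fan q'' (q' :: qs)) ≤ remainingAngle p' q'')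
    (hlt : cross p p' * fan q' qs < cross q q' * fan p' ps) :
    √(fan p (p' :: ps) * fan q (q' :: qs)) ≤ remainingAngle p q := by
  obtain ⟨c1, c2, n1, n2, x1, x2, hpol⟩ := H
  have c1' := (List.isChain_cons_cons.1 c1)
  have c2' := (List.isChain_cons_cons.1 c2)
  have hs := c1'.1
  have ht := c2'.1
  have hS := fan_nonneg _ _ c1'.2
  have hT := fan_nonneg _ _ c2'.2
  have hps : ps ≠ [] := by
    rintro rfl
    simp only [fan, mul_zero] at hlt
    nlinarith [mul_nonneg hs.le hT]
  have hS' := fan_pos hps c1'.2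
  set s := cross p p' with hsdef
  set t := cross q q' with htdef
  set S' := fan p' ps with hSdef
  set T' := fan q' qs with hTdef
  have hfp : fan p (p' :: ps) = s + S' := rfl
  have hfq : fan q (q' :: qs) = t + T' := rfl
  set l : ℝ := s * (t + T') / (t * (s + S')) with hl
  have hden : 0 < t * (s + S') := by positivity
  have hl0 : 0 < l := by positivity
  have hl1 : l < 1 := by
    rw [hl, div_lt_one hden]
    nlinarith
  set q'' : ℝ × ℝ := (q.1 + l * (q'.1 - q.1), q.2 + l * (q'.2 - q.2)) with hq''
  have hq0 := n2 q (by simp)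
  have hq0' := n2 q' (by simp)
  have hp0 := n1 p (by simp)
  have hp0' := n1 p' (by simp)
  have e1 : cross q q'' = l * t := by
    simp only [htdef, hq'', cross]; ring
  have e2 : cross q'' q' = (1 - l) * t := by
    simp only [htdef, hq'', cross]; ring
  have hq1'' : 0 < q''.1 := by
    have := hq0'.1
    simp only [Prod.fst_zero] at this
    simp only [hq'']
    nlinarith [mul_pos (sub_pos.2 hl1) x2, mul_nonneg hl0.le this]
  have hq2'' : 0 ≤ q''.2 := by
    have h1 := hq0'.2
    have h2 := hq0.2
    simp only [Prod.snd_zero] at h1 h2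
    simp only [hq'']
    nlinarith [mul_nonneg (sub_pos.2 hl1).le h2, mul_nonneg hl0.le h1]
  have hq''0 : 0 ≤ q'' := ⟨hq1''.le, hq2''⟩
  have hpol' : ∀ z ∈ p :: p' :: ps, z.1 * q''.1 + z.2 * q''.2 ≤ 1 := by
    intro z hz
    have h1 := hpol z hz q (by simp)
    have h2 := hpol z hz q' (by simp)
    simp only [hq'']
    nlinarith [mul_nonneg (sub_pos.2 hl1).le (sub_nonneg.2 h1), mul_nonneg hl0.le (sub_nonneg.2 h2)]
  have hD : DualChains p' ps q'' (q' :: qs) := by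
    refine ⟨c1'.2, ?_, fun z hz => n1 z (by simp [List.mem_cons.1 hz]), ?_,
      chain_fst_pos hps c1'.2 fun z hz => n1 z (by simp [List.mem_cons.1 hz]), hq1'', ?_⟩
    · rw [List.isChain_cons_cons]
      exact ⟨by rw [e2]; exact mul_pos (sub_pos.2 hl1) ht, c2'.2⟩
    · intro z hz
      rcases List.mem_cons.1 hz with rfl | hz
      · exact hq''0
      · exact n2 z (List.mem_cons_of_mem _ hz)
    · intro z hz w hw
      rcases List.mem_cons.1 hw with rfl | hw
      · exact hpol' z (List.mem_cons_of_mem _ hz)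
      · exact hpol z (List.mem_cons_of_mem _ hz) w (List.mem_cons_of_mem _ hw)
  have hih := ih q'' hD hps
  have hstep := sqrt_le_remainingAngle_sub hp0 hq0 hp0' hq''0 hs.le
    (by rw [e1]; positivity) x1 x2 hD.pos_left hq1'' (hpol p (by simp) q (by simp))
    (hpol' p' (by simp))
  rw [e1] at hstep
  have hf'' : fan q'' (q' :: qs) = (1 - l) * t + T' := by
    simp only [fan, ← hTdef, e2]
  rw [hf''] at hih
  rw [hfp, hfq]
  -- Both areas shrink by the same factor, so the square roots add up.
  have hne : s + S' ≠ 0 := by positivity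
  set κ : ℝ := (t + T') / (s + S') with hκ
  have hκ0 : 0 ≤ κ := by positivity
  have k1 : (s + S') * (t + T') = (s + S') ^ 2 * κ := by
    rw [hκ]; field_simp
  have k2 : s * (l * t) = s ^ 2 * κ := by
    rw [hκ, hl]; field_simp
  have k3 : S' * ((1 - l) * t + T') = S' ^ 2 * κ := by
    have : l * t = s * κ := by rw [hκ, hl]; field_simp
    have h2 : t + T' = (s + S') * κ := by rw [hκ]; field_simp
    have : (1 - l) * t + T' = S' * κ := by linarith
    rw [this]; ring
  rw [k2, Real.sqrt_mul (sq_nonneg _), Real.sqrt_sq hs.le] at hstep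
  rw [k3, Real.sqrt_mul (sq_nonneg _), Real.sqrt_sq hS'.le] at hih
  rw [k1, Real.sqrt_mul (sq_nonneg _), Real.sqrt_sq (by positivity)]
  linarith

/-- The case in which the first segments of the two chains are used up simultaneously. -/
lemma DualChains.sqrt_le_of_eq {p p' q q' : ℝ × ℝ} {ps qs : List (ℝ × ℝ)}
    (H : DualChains p (p' :: ps) q (q' :: qs))
    (ih : DualChains p' ps q' qs → ps ≠ [] → qs ≠ [] →
      √(fan p' ps * fan q' qs) ≤ remainingAngle p' q')
    (heq : cross p p' * fan q' qs = cross q q' * fan p' ps) :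
    √(fan p (p' :: ps) * fan q (q' :: qs)) ≤ remainingAngle p q := by
  obtain ⟨c1, c2, n1, n2, x1, x2, hpol⟩ := H
  have c1' := (List.isChain_cons_cons.1 c1)
  have c2' := (List.isChain_cons_cons.1 c2)
  have hs := c1'.1
  have ht := c2'.1
  have hq0 := n2 q (by simp)
  have hq0' := n2 q' (by simp)
  have hp0 := n1 p (by simp)
  have hp0' := n1 p' (by simp)
  by_cases hps : ps = []
  · have hqs : qs = [] := by
      by_contra hqs
      have := fan_pos hqs c2'.2
      subst hps
      simp only [fan, mul_zero] at heq
      exact (mul_pos hs this).ne' heq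
    subst hps hqs
    simp only [fan, add_zero]
    have h1 := sqrt_cross_mul_cross_le hp0 hq0 hp0' hq0' hs.le ht.le
    exact h1.trans (cross_le_pi_div_two_sub (Real.sqrt_pos.2 (mul_pos x1 x2)) (Real.sqrt_nonneg _)
      (geom_sq_le hp0 hq0 (hpol _ (by simp) _ (by simp)))
      (geom_sq_le hp0' hq0' (hpol _ (by simp) _ (by simp))) ((Real.sqrt_nonneg _).trans h1))
  · have hS' := fan_pos hps c1'.2
    have hqs : qs ≠ [] := by
      rintro rfl
      simp only [fan, mul_zero] at heq
      exact (mul_pos ht hS').ne heq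
    have hT' := fan_pos hqs c2'.2
    have hD : DualChains p' ps q' qs :=
      ⟨c1'.2, c2'.2, fun z hz => n1 z (List.mem_cons_of_mem _ hz),
        fun z hz => n2 z (List.mem_cons_of_mem _ hz),
        chain_fst_pos hps c1'.2 fun z hz => n1 z (List.mem_cons_of_mem _ hz),
        chain_fst_pos hqs c2'.2 fun z hz => n2 z (List.mem_cons_of_mem _ hz),
        fun z hz w hw => hpol z (List.mem_cons_of_mem _ hz) w (List.mem_cons_of_mem _ hw)⟩
    have hih := ih hD hps hqs
    have hstep := sqrt_le_remainingAngle_sub hp0 hq0 hp0' hq0' hs.le ht.le x1 x2 hD.pos_left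
      hD.pos_right (hpol p (by simp) q (by simp)) (hpol p' (by simp) q' (by simp))
    simp only [fan]
    set s := cross p p'
    set t := cross q q'
    set S' := fan p' ps
    set T' := fan q' qs
    have k1 : t = s * (T' / S') := by field_simp; linarith
    have k2 : T' = S' * (T' / S') := by field_simp
    set κ : ℝ := T' / S'
    rw [show s * t = s ^ 2 * κ by rw [k1]; ring, Real.sqrt_mul (sq_nonneg _),
      Real.sqrt_sq hs.le] at hstep
    rw [show S' * T' = S' ^ 2 * κ by rw [k2]; ring, Real.sqrt_mul (sq_nonneg _),
      Real.sqrt_sq hS'.le] at hih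
    rw [show (s + S') * (t + T') = (s + S') ^ 2 * κ by rw [k1, k2]; ring,
      Real.sqrt_mul (sq_nonneg _), Real.sqrt_sq (by positivity)]
    linarith

lemma DualChains.sqrt_fan_mul_fan_le (n : ℕ) : ∀ (p : ℝ × ℝ) (ps : List (ℝ × ℝ)) (q : ℝ × ℝ)
    (qs : List (ℝ × ℝ)), ps.length + qs.length ≤ n → DualChains p ps q qs → ps ≠ [] → qs ≠ [] →
    √(fan p ps * fan q qs) ≤ remainingAngle p q := by
  induction n with
  | zero =>
    intro p ps q qs hn _ hps
    cases ps with
    | nil => exact absurd rfl hps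
    | cons => simp at hn
  | succ n ih =>
    intro p ps q qs hn H hps hqs
    obtain ⟨p', ps, rfl⟩ := List.exists_cons_of_ne_nil hps
    obtain ⟨q', qs, rfl⟩ := List.exists_cons_of_ne_nil hqs
    simp only [List.length_cons] at hn
    rcases lt_trichotomy (cross p p' * fan q' qs) (cross q q' * fan p' ps) with h | h | h
    · exact H.sqrt_le_of_lt (fun q'' H' hne => ih _ _ _ _ (by simp; omega) H' hne (by simp)) h
    · exact H.sqrt_le_of_eq (fun H' hne hne' => ih _ _ _ _ (by omega) H' hne hne') h
    · rw [mul_comm, remainingAngle_comm]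
      exact H.symm.sqrt_le_of_lt (fun q'' H' hne => ih _ _ _ _ (by simp; omega) H' hne (by simp)) h

/-- The Blaschke–Santaló inequality in a quadrant, for polygonal chains. -/
theorem DualChains.fan_mul_fan_le {p q : ℝ × ℝ} {ps qs : List (ℝ × ℝ)}
    (H : DualChains p ps q qs) (hps : ps ≠ []) (hqs : qs ≠ []) :
    fan p ps * fan q qs ≤ (Real.pi / 2) ^ 2 := by
  have h := (DualChains.sqrt_fan_mul_fan_le _ p ps q qs le_rfl H hps hqs).trans
    (remainingAngle_le p q)
  exact (Real.sqrt_le_left (by positivity)).1 h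

/-! ### Chains of velocities -/

/-- A step of a chain: its duration and its final velocity. -/
abbrev Step := ℝ × (ℝ × ℝ)

/-- `IsConvexChain g s`: starting with velocity `g`, the steps `s` have positive durations, and the
velocity turns left during each step by at least the duration, measured by the determinant. During a
step the velocity is thought of as interpolating linearly, so that the motion runs along an arc of
parabola, whose control polygon consists of `δ / 2` times the first velocity and `δ / 2` times the
second one; then the duration is at most the affine length of the arc. -/
def IsConvexChain : ℝ × ℝ → List Step → Prop
  | _, [] => True
  | g, (δ, g') :: s => 0 < δ ∧ δ ≤ cross g g' ∧ IsConvexChain g' s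

/-- The total duration of a chain. -/
def duration : List Step → ℝ
  | [] => 0
  | (δ, _) :: s => δ + duration s

/-- The final velocity of a chain. -/
def lastVel : ℝ × ℝ → List Step → ℝ × ℝ
  | g, [] => g
  | _, (_, g') :: s => lastVel g' s

/-- The total displacement of a chain. -/
noncomputable def disp : ℝ × ℝ → List Step → ℝ × ℝ
  | _, [] => 0
  | g, (δ, g') :: s => (δ / 2) • (g + g') + disp g' s

/-- Twice the area swept from the origin by the control polygon of a chain starting at `p`. -/
noncomputable def area2 : ℝ × ℝ → ℝ × ℝ → List Step → ℝ
  | _, _, [] => 0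
  | p, g, (δ, g') :: s => δ / 2 * cross p g + δ / 2 * cross (p + (δ / 2) • g) g' +
      area2 (p + (δ / 2) • (g + g')) g' s

/-- The vertices of the control polygon of a chain starting at `p`, together with the points where
it touches the parabolas; the point `p` itself is left out. -/
noncomputable def pts : ℝ × ℝ → ℝ × ℝ → List Step → List (ℝ × ℝ)
  | _, _, [] => []
  | p, g, (δ, g') :: s => (p + (δ / 2) • g) :: (p + (δ / 2) • (g + g')) ::
      pts (p + (δ / 2) • (g + g')) g' s

/-- The positions and velocities at the ends of the steps of a chain starting at `p`. -/
noncomputable def touches : ℝ × ℝ → ℝ × ℝ → List Step → List ((ℝ × ℝ) × (ℝ × ℝ))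
  | _, _, [] => []
  | p, g, (δ, g') :: s => (p + (δ / 2) • (g + g'), g') ::
      touches (p + (δ / 2) • (g + g')) g' s

/-- The polar point of the line through a given point in a given direction. -/
noncomputable def polarPt (t : (ℝ × ℝ) × (ℝ × ℝ)) : ℝ × ℝ :=
  (t.2.2 / cross t.1 t.2, -t.2.1 / cross t.1 t.2)

lemma fan_pts : ∀ (s : List Step) (p g : ℝ × ℝ), fan p (pts p g s) = area2 p g s
  | [], _, _ => rfl
  | (δ, g') :: s, p, g => by
    simp only [pts, fan, area2, fan_pts s]
    simp only [cross, Prod.fst_add, Prod.snd_add, Prod.smul_fst, Prod.smul_snd, smul_eq_mul]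
    ring

lemma cross_polarPt {t t' : (ℝ × ℝ) × (ℝ × ℝ)} (h : 0 < cross t.1 t.2) (h' : 0 < cross t'.1 t'.2) :
    cross (polarPt t) (polarPt t') = cross t.2 t'.2 / (cross t.1 t.2 * cross t'.1 t'.2) := by
  simp only [polarPt]
  set a := cross t.1 t.2
  set b := cross t'.1 t'.2
  simp only [cross]
  field_simp
  ring

lemma pow_three_le_of_le_mul {x a b c : ℝ} (ha : 0 ≤ a) (hb : 0 ≤ b) (hc : 0 ≤ c)
    (h : x ^ 3 ≤ a * b * c) : 3 * x ≤ a + b + c := by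
  by_contra hlt
  push Not at hlt
  have h0 : 0 ≤ a + b + c := by positivity
  have h1 : (a + b + c) ^ 3 < (3 * x) ^ 3 := by gcongr
  have h2 : 27 * (a * b * c) ≤ (a + b + c) ^ 3 := by
    nlinarith [mul_nonneg ha (sq_nonneg (b - c)), mul_nonneg hb (sq_nonneg (a - c)),
      mul_nonneg hc (sq_nonneg (a - b)), mul_nonneg h0 (sq_nonneg (b - c)),
      mul_nonneg h0 (sq_nonneg (a - c)), mul_nonneg h0 (sq_nonneg (a - b))]
  nlinarith

/-- The arithmetic–geometric mean inequality behind the affine isoperimetric inequality: the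
duration of a step is at most the geometric mean of the areas swept by its two halves (doubled) and
of the area swept by the polar chain. -/
lemma three_mul_duration_le {S D M : ℝ} (hS : 0 < S) (hD : 0 < D) (hM : 0 < M)
    (hMSD : M ^ 3 = S ^ 2 * D) : ∀ (s : List Step) (p g : ℝ × ℝ), IsConvexChain g s →
    (∀ t ∈ (p, g) :: touches p g s, 0 < cross t.1 t.2) →
    3 * duration s ≤ M * (fan (polarPt (p, g)) ((touches p g s).map polarPt) / D +
      2 * area2 p g s / S)
  | [], p, g, _, _ => by simp [duration, fan, touches, area2]
  | (δ, g') :: s, p, g, hs, ht => by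
    obtain ⟨hδ, hδ', hs⟩ := hs
    simp only [touches] at ht
    have ih := three_mul_duration_le hS hD hM hMSD s _ g' hs
      fun t h => ht t (List.mem_cons_of_mem _ h)
    have h1 : 0 < cross p g := ht (p, g) (by simp)
    have h2 : 0 < cross (p + (δ / 2) • (g + g')) g' := ht (_, g') (by simp)
    simp only [duration, touches, List.map_cons, fan, area2]
    have hc : cross (p + (δ / 2) • g) g' = cross (p + (δ / 2) • (g + g')) g' := by
      simp only [cross, Prod.fst_add, Prod.snd_add, Prod.smul_fst, Prod.smul_snd, smul_eq_mul]
      ring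
    rw [cross_polarPt h1 h2, hc]
    set F := fan (polarPt (p + (δ / 2) • (g + g'), g')) ((touches (p + (δ / 2) • (g + g')) g' s).map
      polarPt)
    set E := area2 (p + (δ / 2) • (g + g')) g' s
    simp only
    set h := cross p g
    set h' := cross (p + (δ / 2) • (g + g')) g'
    have key : 3 * (δ / M) ≤ cross g g' / (h * h') / D + δ * h / S + δ * h' / S := by
      have hg : 0 < cross g g' := hδ.trans_le hδ'
      apply pow_three_le_of_le_mul (by positivity) (by positivity) (by positivity)
      have e : cross g g' / (h * h') / D * (δ * h / S) * (δ * h' / S) =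
          cross g g' * δ ^ 2 / M ^ 3 := by
        rw [hMSD]; field_simp
      rw [e, div_pow]
      gcongr
      nlinarith [sq_nonneg δ]
    have key2 : 3 * δ ≤ M * (cross g g' / (h * h') / D + δ * h / S + δ * h' / S) := by
      have := mul_le_mul_of_nonneg_left key hM.le
      calc 3 * δ = M * (3 * (δ / M)) := by field_simp
        _ ≤ _ := this
    calc 3 * (δ + duration s) = 3 * δ + 3 * duration s := by ring
      _ ≤ _ := add_le_add key2 ih
      _ = _ := by ring

/-- The velocities of a chain after the first one. -/
def vels (s : List Step) : List (ℝ × ℝ) := s.map Prod.snd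

lemma IsConvexChain.isChain : ∀ {s : List Step} {g : ℝ × ℝ}, IsConvexChain g s →
    (g :: vels s).IsChain (fun a b => 0 < cross a b)
  | [], _, _ => by simp [vels]
  | (δ, g') :: s, g, h => by
    have := IsConvexChain.isChain h.2.2
    simp only [vels, List.map_cons, List.isChain_cons_cons] at *
    exact ⟨h.1.trans_le h.2.1, this⟩

lemma IsConvexChain.duration_nonneg : ∀ {s : List Step} {g : ℝ × ℝ}, IsConvexChain g s →
    0 ≤ duration s
  | [], _, _ => le_rfl
  | (_, _) :: _, _, h => add_nonneg h.1.le h.2.2.duration_nonneg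

/-- The velocities considered for an arc in the first quadrant traversed counterclockwise. -/
def InQuadrant (g : ℝ × ℝ) : Prop := g.1 ≤ 0 ∧ 0 ≤ g.2

lemma pairwise_of_isChain : ∀ (l : List (ℝ × ℝ)), (∀ g ∈ l, InQuadrant g) →
    l.IsChain (fun a b => 0 < cross a b) → l.Pairwise (fun a b => 0 < cross a b)
  | [], _, _ => by simp
  | [_], _, _ => by simp
  | g :: g' :: l, hq, hc => by
    rw [List.isChain_cons_cons] at hc
    have ih := pairwise_of_isChain (g' :: l) (fun x hx => hq x (List.mem_cons_of_mem _ hx)) hc.2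
    rw [List.pairwise_cons]
    refine ⟨fun x hx => ?_, ih⟩
    rcases List.mem_cons.1 hx with rfl | hx
    · exact hc.1
    · have h1 := (List.pairwise_cons.1 ih).1 x hx
      have h2 := hc.1
      obtain ⟨a1, a2⟩ := hq g (by simp)
      obtain ⟨b1, b2⟩ := hq g' (by simp)
      obtain ⟨c1, c2⟩ := hq x (by simp [hx])
      simp only [cross] at *
      have hb1 : g'.1 < 0 := by
        by_contra h
        have : g'.1 = 0 := by linarith
        rw [this] at h2
        nlinarith [mul_nonneg (neg_nonneg.2 a1) b2]
      have hb2 : 0 < g'.2 := by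
        by_contra h
        have : g'.2 = 0 := by linarith
        rw [this] at h1
        nlinarith [mul_nonneg (neg_nonneg.2 b1) c2]
      have hc1 : x.1 < 0 := by
        by_contra h
        have : x.1 = 0 := by linarith
        rw [this] at h1
        nlinarith [mul_nonneg (neg_nonneg.2 b1) c2]
      -- `g' = α g + β x` with positive `α`, `β`, read off from the three determinants
      have e : g'.1 * (g.1 * x.2 - g.2 * x.1) =
          g.1 * (g'.1 * x.2 - g'.2 * x.1) + x.1 * (g.1 * g'.2 - g.2 * g'.1) := by ring
      have : g'.1 * (g.1 * x.2 - g.2 * x.1) < 0 := by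
        rw [e]
        nlinarith [mul_nonneg (neg_nonneg.2 a1) h1.le, mul_pos (neg_pos.2 hc1) h2]
      by_contra hcon
      nlinarith [mul_nonneg (neg_nonneg.2 hb1.le) (sub_nonneg.2 (not_lt.1 hcon))]

lemma IsConvexChain.vels_fst_neg : ∀ {s : List Step} {g : ℝ × ℝ}, IsConvexChain g s →
    (∀ d ∈ g :: vels s, InQuadrant d) → ∀ d ∈ vels s, d.1 < 0
  | [], _, _, _ => by simp [vels]
  | (δ, g') :: s, g, h, hq => by
    simp only [vels, List.map_cons] at *
    intro d hd
    rcases List.mem_cons.1 hd with rfl | hd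
    · have h1 := h.1.trans_le h.2.1
      obtain ⟨a1, a2⟩ := hq g (by simp)
      obtain ⟨b1, b2⟩ := hq d (by simp)
      simp only [cross] at h1
      by_contra hcon
      have : d.1 = 0 := by linarith
      rw [this] at h1
      nlinarith [mul_nonneg (neg_nonneg.2 a1) b2]
    · exact IsConvexChain.vels_fst_neg h.2.2
        (fun x hx => hq x (List.mem_cons_of_mem _ (by simpa [vels] using hx))) d
        (by simpa [vels] using hd)

lemma cross_add_left (a b c : ℝ × ℝ) : cross (a + b) c = cross a c + cross b c := by
  simp only [cross, Prod.fst_add, Prod.snd_add]; ring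

lemma cross_add_right (a b c : ℝ × ℝ) : cross a (b + c) = cross a b + cross a c := by
  simp only [cross, Prod.fst_add, Prod.snd_add]; ring

lemma cross_smul_left (r : ℝ) (a b : ℝ × ℝ) : cross (r • a) b = r * cross a b := by
  simp only [cross, Prod.smul_fst, Prod.smul_snd, smul_eq_mul]; ring

lemma cross_smul_right (r : ℝ) (a b : ℝ × ℝ) : cross a (r • b) = r * cross a b := by
  simp only [cross, Prod.smul_fst, Prod.smul_snd, smul_eq_mul]; ring

lemma cross_self (a : ℝ × ℝ) : cross a a = 0 := by
  simp only [cross]; ring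

lemma cross_swap (a b : ℝ × ℝ) : cross a b = - cross b a := by
  simp only [cross]; ring

lemma cross_zero_right (a : ℝ × ℝ) : cross a 0 = 0 := by simp [cross]

/-- A functional that is nonnegative on all velocities is monotone along the chain. -/
lemma IsConvexChain.cross_le_of_mem_pts (f : ℝ × ℝ) : ∀ {s : List Step} {p g : ℝ × ℝ},
    IsConvexChain g s → (∀ d ∈ g :: vels s, 0 ≤ cross f d) →
    ∀ z ∈ p :: pts p g s, cross f p ≤ cross f z ∧ cross f z ≤ cross f (p + disp g s)
  | [], p, g, _, _ => by simp [pts, disp]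
  | (δ, g') :: s, p, g, h, hf => by
    simp only [vels, List.map_cons] at hf
    have h1 := hf g (by simp)
    have h2 := hf g' (by simp)
    have hδ := h.1
    have ih := IsConvexChain.cross_le_of_mem_pts f (p := p + (δ / 2) • (g + g')) h.2.2
      fun d hd => hf d (List.mem_cons_of_mem _ (by simpa [vels] using hd))
    have hlast := (ih (p + (δ / 2) • (g + g')) (by simp)).2
    simp only [pts, disp, ← add_assoc]
    have e1 : cross f (p + (δ / 2) • g) = cross f p + δ / 2 * cross f g := by
      rw [cross_add_right, cross_smul_right]
    have e2 : cross f (p + (δ / 2) • (g + g')) =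
        cross f p + δ / 2 * cross f g + δ / 2 * cross f g' := by
      rw [cross_add_right, cross_smul_right, cross_add_right]; ring
    have p1 : 0 ≤ δ / 2 * cross f g := by positivity
    have p2 : 0 ≤ δ / 2 * cross f g' := by positivity
    intro z hz
    rcases List.mem_cons.1 hz with rfl | hz
    · exact ⟨le_rfl, by linarith⟩
    rcases List.mem_cons.1 hz with rfl | hz
    · exact ⟨by linarith, by linarith⟩
    · have := ih z hz
      exact ⟨by linarith, this.2⟩

lemma vels_of_mem_touches : ∀ {s : List Step} {p g : ℝ × ℝ} {t : (ℝ × ℝ) × (ℝ × ℝ)},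
    t ∈ touches p g s → t.2 ∈ vels s
  | [], _, _, _, h => by simp [touches] at h
  | (δ, g') :: s, p, g, t, h => by
    simp only [touches] at h
    simp only [vels, List.map_cons]
    rcases List.mem_cons.1 h with rfl | h
    · simp
    · exact List.mem_cons_of_mem _ (vels_of_mem_touches h)

/-- Every point of a convex chain lies on the left of each of its tangents. -/
lemma IsConvexChain.cross_le_of_mem_touches : ∀ {s : List Step} {p g : ℝ × ℝ},
    IsConvexChain g s → (g :: vels s).Pairwise (fun a b => 0 < cross a b) →
    ∀ z ∈ p :: pts p g s, ∀ t ∈ (p, g) :: touches p g s, cross z t.2 ≤ cross t.1 t.2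
  | [], p, g, _, _ => by simp [pts, touches]
  | (δ, g') :: s, p, g, h, hp => by
    have hδ := h.1
    have hp' := List.pairwise_cons.1 hp
    have ih := IsConvexChain.cross_le_of_mem_touches (p := p + (δ / 2) • (g + g')) h.2.2 hp'.2
    have hA := IsConvexChain.cross_le_of_mem_pts g (p := p) h (fun d hd => by
      rcases List.mem_cons.1 hd with rfl | hd
      · rw [cross_self]
      · exact (hp'.1 d hd).le)
    intro z hz t ht
    rcases List.mem_cons.1 ht with rfl | ht
    · have := (hA z hz).1
      rw [cross_swap z, cross_swap p]
      simp only
      linarith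
    simp only [touches] at ht
    have hB := ih (p + (δ / 2) • (g + g')) (List.mem_cons_self ..) t ht
    have htv : 0 ≤ cross g t.2 ∧ 0 ≤ cross g' t.2 := by
      rcases List.mem_cons.1 ht with rfl | ht
      · exact ⟨(hp'.1 g' (by simp [vels])).le, by rw [cross_self]⟩
      · have := vels_of_mem_touches ht
        exact ⟨(hp'.1 _ (by simp only [vels, List.map_cons]; exact List.mem_cons_of_mem _ this)).le,
          ((List.pairwise_cons.1 hp'.2).1 _ this).le⟩
    have e2 : cross (p + (δ / 2) • (g + g')) t.2 =
        cross p t.2 + δ / 2 * cross g t.2 + δ / 2 * cross g' t.2 := by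
      rw [cross_add_left, cross_smul_left, cross_add_left]; ring
    have e1 : cross (p + (δ / 2) • g) t.2 = cross p t.2 + δ / 2 * cross g t.2 := by
      rw [cross_add_left, cross_smul_left]
    have p1 : 0 ≤ δ / 2 * cross g t.2 := mul_nonneg (by linarith) htv.1
    have p2 : 0 ≤ δ / 2 * cross g' t.2 := mul_nonneg (by linarith) htv.2
    simp only [pts] at hz
    rcases List.mem_cons.1 hz with rfl | hz
    · linarith
    rcases List.mem_cons.1 hz with rfl | hz
    · linarith
    · exact ih z hz t ht

lemma isChain_pts : ∀ {s : List Step} {p g : ℝ × ℝ}, IsConvexChain g s →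
    (∀ t ∈ (p, g) :: touches p g s, 0 < cross t.1 t.2) →
    (p :: pts p g s).IsChain (fun a b => 0 < cross a b)
  | [], _, _, _, _ => by simp [pts]
  | (δ, g') :: s, p, g, h, ht => by
    simp only [touches] at ht
    have ih := isChain_pts (p := p + (δ / 2) • (g + g')) h.2.2
      fun t h => ht t (List.mem_cons_of_mem _ h)
    have h1 : 0 < cross p g := ht (p, g) (by simp)
    have h2 : 0 < cross (p + (δ / 2) • (g + g')) g' := ht (_, g') (by simp)
    have hδ := h.1
    simp only [pts, List.isChain_cons_cons]
    refine ⟨?_, ?_, ih⟩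
    · rw [cross_add_right, cross_self, cross_smul_right]
      have := mul_pos (half_pos hδ) h1
      linarith
    · have e : cross (p + (δ / 2) • g) (p + (δ / 2) • (g + g')) =
          δ / 2 * cross (p + (δ / 2) • (g + g')) g' := by
        simp only [cross, Prod.fst_add, Prod.snd_add, Prod.smul_fst, Prod.smul_snd, smul_eq_mul]
        ring
      rw [e]
      exact mul_pos (half_pos hδ) h2

lemma isChain_polarPt : ∀ {s : List Step} {p g : ℝ × ℝ}, IsConvexChain g s →
    (∀ t ∈ (p, g) :: touches p g s, 0 < cross t.1 t.2) →
    (polarPt (p, g) :: (touches p g s).map polarPt).IsChain (fun a b => 0 < cross a b)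
  | [], _, _, _, _ => by simp [touches]
  | (δ, g') :: s, p, g, h, ht => by
    simp only [touches] at ht
    have ih := isChain_polarPt (p := p + (δ / 2) • (g + g')) h.2.2
      fun t h => ht t (List.mem_cons_of_mem _ h)
    have h1 : 0 < cross p g := ht (p, g) (by simp)
    have h2 : 0 < cross (p + (δ / 2) • (g + g')) g' := ht (_, g') (by simp)
    simp only [touches, List.map_cons, List.isChain_cons_cons]
    refine ⟨?_, ih⟩
    rw [cross_polarPt h1 h2]
    exact div_pos (h.1.trans_le h.2.1) (mul_pos h1 h2)

/-- The affine isoperimetric inequality for an arc in a quadrant. -/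
theorem IsConvexChain.duration_pow_three_le {s : List Step} {p g : ℝ × ℝ} (h : IsConvexChain g s)
    (hne : s ≠ []) (hq : ∀ d ∈ g :: vels s, InQuadrant d) (hp : 0 ≤ p.2)
    (hend : 0 ≤ (p + disp g s).1) :
    duration s ^ 3 ≤ Real.pi ^ 2 / 4 * area2 p g s := by
  have hpw := pairwise_of_isChain _ hq h.isChain
  have hneg := h.vels_fst_neg hq
  have hpos : 0 < g.2 := by
    obtain ⟨⟨δ, g'⟩, s, rfl⟩ := List.exists_cons_of_ne_nil hne
    have h1 := h.1.trans_le h.2.1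
    have a := hq g (by simp)
    have b := hq g' (by simp [vels])
    by_contra hcon
    have : g.2 = 0 := by linarith [a.2]
    simp only [cross, this] at h1
    nlinarith [mul_nonneg (neg_nonneg.2 a.1) b.2]
  have hlow : ∀ z ∈ p :: pts p g s, p.2 ≤ z.2 := by
    intro z hz
    have := (h.cross_le_of_mem_pts (1, 0) (p := p) (fun d hd => by
      simp only [cross]; linarith [(hq d hd).2]) z hz).1
    simp only [cross] at this
    linarith
  have hleft : ∀ z ∈ p :: pts p g s, (p + disp g s).1 ≤ z.1 := by
    intro z hz
    have := (h.cross_le_of_mem_pts (0, 1) (p := p) (fun d hd => by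
      simp only [cross]; linarith [(hq d hd).1]) z hz).2
    simp only [cross] at this
    linarith
  have hz0 : ∀ z ∈ p :: pts p g s, 0 ≤ z := fun z hz =>
    ⟨hend.trans (hleft z hz), hp.trans (hlow z hz)⟩
  -- There are points of the chain off the vertical axis, and points off the horizontal one.
  obtain ⟨w, hw, hw1, hw2, hp1⟩ : ∃ w ∈ p :: pts p g s, 0 ≤ w.1 ∧ 0 < w.2 ∧ 0 < p.1 := by
    obtain ⟨⟨δ, g'⟩, s, rfl⟩ := List.exists_cons_of_ne_nil hne
    have hmem : p + (δ / 2) • (g + g') ∈ p :: pts p g ((δ, g') :: s) := by simp [pts]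
    have hδ := h.1
    have ha := hq g (by simp)
    have hb := hq g' (by simp [vels])
    have hb' := hneg g' (by simp [vels])
    refine ⟨_, hmem, (hz0 _ hmem).1, ?_, ?_⟩
    · simp only [Prod.snd_add, Prod.smul_snd, smul_eq_mul]
      have : 0 < δ / 2 * (g.2 + g'.2) := mul_pos (half_pos hδ) (by linarith [hb.2])
      linarith
    · have h0 := (hz0 _ hmem).1
      simp only [Prod.fst_add, Prod.smul_fst, smul_eq_mul, Prod.fst_zero] at h0
      have : 0 < δ / 2 * -(g.1 + g'.1) := mul_pos (half_pos hδ) (by linarith [ha.1])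
      linarith
  have hht : ∀ t ∈ (p, g) :: touches p g s, 0 < cross t.1 t.2 := by
    intro t ht
    have h1 := h.cross_le_of_mem_touches hpw p (by simp) t ht
    have h2 := h.cross_le_of_mem_touches hpw w hw t ht
    rcases List.mem_cons.1 ht with rfl | ht'
    · refine lt_of_lt_of_le ?_ h1
      simp only [cross]
      nlinarith [mul_pos hp1 hpos, mul_nonneg hp (neg_nonneg.2 (hq g (by simp)).1)]
    · refine lt_of_lt_of_le ?_ h2
      have hv := vels_of_mem_touches ht'
      simp only [cross]
      nlinarith [mul_pos hw2 (neg_pos.2 (hneg _ hv)),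
        mul_nonneg hw1 (hq _ (List.mem_cons_of_mem _ hv)).2]
  have hpolar : ∀ t ∈ (p, g) :: touches p g s, InQuadrant t.2 := by
    intro t ht
    rcases List.mem_cons.1 ht with rfl | ht'
    · exact hq _ (by simp)
    · exact hq _ (List.mem_cons_of_mem _ (vels_of_mem_touches ht'))
  have hD : DualChains p (pts p g s) (polarPt (p, g)) ((touches p g s).map polarPt) := by
    refine ⟨isChain_pts h hht, isChain_polarPt h hht, hz0, ?_, hp1, ?_, ?_⟩
    · rw [← List.map_cons]
      intro z hz
      obtain ⟨t, ht, rfl⟩ := List.mem_map.1 hz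
      exact ⟨div_nonneg (hpolar t ht).2 (hht t ht).le,
        div_nonneg (neg_nonneg.2 (hpolar t ht).1) (hht t ht).le⟩
    · exact div_pos hpos (hht (p, g) (by simp))
    · rw [← List.map_cons]
      intro z hz y hy
      obtain ⟨t, ht, rfl⟩ := List.mem_map.1 hy
      have h1 := h.cross_le_of_mem_touches hpw z hz t ht
      have h2 := hht t ht
      simp only [polarPt]
      rw [← mul_div_assoc, ← mul_div_assoc, ← add_div, div_le_one h2]
      simp only [cross] at *
      linarith
  have hne1 : pts p g s ≠ [] := by
    obtain ⟨⟨δ, g'⟩, s, rfl⟩ := List.exists_cons_of_ne_nil hne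
    simp [pts]
  have hne2 : (touches p g s).map polarPt ≠ [] := by
    obtain ⟨⟨δ, g'⟩, s, rfl⟩ := List.exists_cons_of_ne_nil hne
    simp [touches]
  have hfan := hD.fan_mul_fan_le hne1 hne2
  have hS := fan_pos hne1 hD.chain_left
  have hT := fan_pos hne2 hD.chain_right
  rw [fan_pts] at hfan hS
  set S := area2 p g s
  set T := fan (polarPt (p, g)) ((touches p g s).map polarPt) with hTdef
  set M : ℝ := (S ^ 2 * T) ^ ((1 : ℝ) / 3) with hMdef
  have hM : 0 < M := by positivity
  have hM3 : M ^ 3 = S ^ 2 * T := by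
    rw [hMdef, ← Real.rpow_natCast, ← Real.rpow_mul (by positivity)]
    norm_num
  have hmain := three_mul_duration_le hS hT hM hM3 s p g h hht
  rw [← hTdef, div_self hT.ne', mul_div_assoc, div_self hS.ne'] at hmain
  have hle : duration s ≤ M := by linarith
  calc duration s ^ 3 ≤ M ^ 3 := pow_le_pow_left₀ h.duration_nonneg hle 3
    _ = S * (S * T) := by rw [hM3]; ring
    _ ≤ S * (Real.pi / 2) ^ 2 := by gcongr
    _ = _ := by ring

/-! ### Splitting and transforming chains -/

lemma duration_append (s t : List Step) : duration (s ++ t) = duration s + duration t := by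
  induction s with
  | nil => simp [duration]
  | cons a s ih => obtain ⟨δ, g'⟩ := a; simp [duration, ih, add_assoc]

lemma lastVel_append (s t : List Step) : ∀ g, lastVel g (s ++ t) = lastVel (lastVel g s) t := by
  induction s with
  | nil => simp [lastVel]
  | cons a s ih => obtain ⟨δ, g'⟩ := a; intro g; simp [lastVel, ih]

lemma disp_append (s t : List Step) :
    ∀ g, disp g (s ++ t) = disp g s + disp (lastVel g s) t := by
  induction s with
  | nil => simp [disp, lastVel]
  | cons a s ih => obtain ⟨δ, g'⟩ := a; intro g; simp [disp, lastVel, ih, add_assoc]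

lemma area2_append (s t : List Step) : ∀ p g, area2 p g (s ++ t) =
    area2 p g s + area2 (p + disp g s) (lastVel g s) t := by
  induction s with
  | nil => simp [disp, lastVel, area2]
  | cons a s ih =>
    obtain ⟨δ, g'⟩ := a
    intro p g
    simp only [List.cons_append, area2, disp, lastVel, ih, ← add_assoc]

lemma isConvexChain_append (s t : List Step) : ∀ g, IsConvexChain g (s ++ t) ↔
    IsConvexChain g s ∧ IsConvexChain (lastVel g s) t := by
  induction s with
  | nil => simp [IsConvexChain, lastVel]
  | cons a s ih =>
    obtain ⟨δ, g'⟩ := a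
    intro g
    simp only [List.cons_append, IsConvexChain, lastVel, ih, and_assoc]

lemma area2_add (v : ℝ × ℝ) : ∀ (s : List Step) (p g : ℝ × ℝ),
    area2 (p + v) g s = area2 p g s + cross v (disp g s)
  | [], p, g => by simp [area2, disp, cross]
  | (δ, g') :: s, p, g => by
    simp only [area2, disp]
    rw [show p + v + (δ / 2) • (g + g') = p + (δ / 2) • (g + g') + v by abel,
      area2_add v s, cross_add_right v]
    simp only [cross, Prod.fst_add, Prod.snd_add, Prod.smul_fst, Prod.smul_snd, smul_eq_mul]
    ring

/-- The image of a chain under a linear map. -/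
def mapSteps (φ : ℝ × ℝ →ₗ[ℝ] ℝ × ℝ) (s : List Step) : List Step :=
  s.map fun t => (t.1, φ t.2)

section map
variable {φ : ℝ × ℝ →ₗ[ℝ] ℝ × ℝ}

lemma duration_mapSteps (s : List Step) : duration (mapSteps φ s) = duration s := by
  induction s with
  | nil => rfl
  | cons a s ih => obtain ⟨δ, g'⟩ := a; simpa [duration, mapSteps] using ih

lemma disp_mapSteps (s : List Step) : ∀ g, disp (φ g) (mapSteps φ s) = φ (disp g s) := by
  induction s with
  | nil => simp [mapSteps, disp]
  | cons a s ih =>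
    obtain ⟨δ, g'⟩ := a
    intro g
    simp only [mapSteps] at ih
    simp [mapSteps, disp, ih]

lemma area2_mapSteps (hφ : ∀ a b, cross (φ a) (φ b) = cross a b) (s : List Step) :
    ∀ p g, area2 (φ p) (φ g) (mapSteps φ s) = area2 p g s := by
  induction s with
  | nil => simp [mapSteps, area2]
  | cons a s ih =>
    obtain ⟨δ, g'⟩ := a
    intro p g
    simp only [mapSteps] at ih
    simp only [mapSteps, List.map_cons, area2, ← map_add, ← map_smul, hφ, ih]

lemma isConvexChain_mapSteps (hφ : ∀ a b, cross (φ a) (φ b) = cross a b) (s : List Step) :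
    ∀ g, IsConvexChain (φ g) (mapSteps φ s) ↔ IsConvexChain g s := by
  induction s with
  | nil => simp [mapSteps, IsConvexChain]
  | cons a s ih =>
    obtain ⟨δ, g'⟩ := a
    intro g
    simp only [mapSteps] at ih
    simp only [mapSteps, List.map_cons, IsConvexChain, hφ, ih]

lemma vels_mapSteps (s : List Step) : vels (mapSteps φ s) = (vels s).map φ := by
  simp [vels, mapSteps, Function.comp_def]
end map

/-- A step may be divided at a velocity in between. This preserves durations and displacements,
and it cuts off a corner of the control polygon. -/
lemma exists_split_step {f g g' : ℝ × ℝ} {δ : ℝ} (hδ : 0 < δ) (hδ' : δ ≤ cross g g')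
    (hg : 0 < cross g f) (hg' : cross g' f < 0) :
    ∃ z : ℝ × ℝ, ∃ a b : ℝ, cross z f = 0 ∧ 0 < a ∧ 0 < b ∧ a + b = δ ∧ a ≤ cross g z ∧
      b ≤ cross z g' ∧ (∀ e, 0 ≤ cross g e → 0 ≤ cross g' e → 0 ≤ cross z e) ∧
      (a / 2) • (g + z) + (b / 2) • (z + g') = (δ / 2) • (g + g') ∧
      ∀ p, area2 p g [(a, z), (b, g')] ≤ area2 p g [(δ, g')] := by
  have hd : 0 < cross g f - cross g' f := by linarith
  set t : ℝ := cross g f / (cross g f - cross g' f) with ht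
  have ht0 : 0 < t := div_pos hg hd
  have ht1 : t < 1 := by rw [ht, div_lt_one hd]; linarith
  have hgg : 0 < cross g g' := hδ.trans_le hδ'
  refine ⟨(1 - t) • g + t • g', t * δ, (1 - t) * δ, ?_, by positivity,
    mul_pos (by linarith) hδ, by ring, ?_, ?_, ?_, ?_, ?_⟩
  · rw [cross_add_left, cross_smul_left, cross_smul_left]
    have : t * (cross g f - cross g' f) = cross g f := div_mul_cancel₀ _ hd.ne'
    linarith
  · rw [cross_add_right, cross_smul_right, cross_smul_right, cross_self]
    nlinarith
  · rw [cross_add_left, cross_smul_left, cross_smul_left, cross_self]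
    nlinarith
  · intro e h1 h2
    rw [cross_add_left, cross_smul_left, cross_smul_left]
    have := mul_nonneg (sub_pos.2 ht1).le h1
    have := mul_nonneg ht0.le h2
    linarith
  · ext <;> simp <;> ring
  · intro p
    have key : area2 p g [(δ, g')] - area2 p g [(t * δ, (1 - t) • g + t • g'),
        ((1 - t) * δ, g')] = t * (1 - t) * (δ ^ 2 / 4) * cross g g' := by
      simp only [area2, cross, Prod.fst_add, Prod.snd_add, Prod.smul_fst, Prod.smul_snd,
        smul_eq_mul]
      ring
    have : 0 ≤ t * (1 - t) * (δ ^ 2 / 4) * cross g g' :=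
      mul_nonneg (mul_nonneg (mul_nonneg ht0.le (by linarith)) (by positivity)) hgg.le
    linarith

/-- A chain whose velocities pass from the open positive side of a line to the other side can be
divided at a velocity on that line. -/
lemma exists_split_chain {f : ℝ × ℝ} : ∀ {s : List Step} {g : ℝ × ℝ}, IsConvexChain g s →
    0 < cross g f → (∃ d ∈ vels s, cross d f ≤ 0) →
    ∃ (s₁ s₂ : List Step) (z : ℝ × ℝ), s₁ ≠ [] ∧ IsConvexChain g s₁ ∧ lastVel g s₁ = z ∧
      IsConvexChain z s₂ ∧ z ∈ vels s₁ ∧ cross z f = 0 ∧ (∀ d ∈ vels s₁, 0 ≤ cross d f) ∧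
      duration s₁ + duration s₂ = duration s ∧ disp g s₁ + disp z s₂ = disp g s ∧
      (∀ p, area2 p g s₁ + area2 (p + disp g s₁) z s₂ ≤ area2 p g s) ∧
      ∀ e, (∀ d ∈ g :: vels s, 0 ≤ cross d e) →
        (∀ d ∈ vels s₁, 0 ≤ cross d e) ∧ ∀ d ∈ vels s₂, 0 ≤ cross d e
  | [], _, _, _, ⟨_, hd, _⟩ => by simp [vels] at hd
  | (δ, g') :: s, g, h, hg, hex => by
    obtain ⟨hδ, hδ', hs⟩ := h
    rcases lt_trichotomy (cross g' f) 0 with hlt | heq | hgt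
    · obtain ⟨z, a, b, hz, ha, hb, hab, haz, hbz, hze, hdisp, harea⟩ :=
        exists_split_step hδ hδ' hg hlt
      refine ⟨[(a, z)], (b, g') :: s, z, by simp, ⟨ha, haz, trivial⟩, rfl, ⟨hb, hbz, hs⟩,
        by simp [vels], hz, by simp [vels, hz], ?_, ?_, ?_, ?_⟩
      · simp only [duration]; linarith
      · simp only [disp, add_zero, ← hdisp, add_assoc]
      · intro p
        have h1 := harea p
        simp only [area2, disp, add_zero] at h1 ⊢
        rw [← hdisp, ← add_assoc p]
        linarith
      · intro e he
        simp only [vels, List.map_cons, List.mem_cons, forall_eq_or_imp, List.map_nil] at he ⊢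
        exact ⟨⟨hze e he.1 he.2.1, by simp⟩, he.2.1, he.2.2⟩
    · refine ⟨[(δ, g')], s, g', by simp, ⟨hδ, hδ', trivial⟩, rfl, hs, by simp [vels], heq,
        by simp [vels, heq], by simp [duration], by simp [disp], fun p => ?_, fun e he => ?_⟩
      · simp [disp, area2]
      · simp only [vels, List.map_cons, List.mem_cons, forall_eq_or_imp, List.map_nil] at he ⊢
        exact ⟨⟨he.2.1, by simp⟩, he.2.2⟩
    · have hex' : ∃ d ∈ vels s, cross d f ≤ 0 := by
        obtain ⟨d, hd, hdf⟩ := hex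
        simp only [vels, List.map_cons] at hd
        rcases List.mem_cons.1 hd with rfl | hd
        · exact absurd hdf (not_le.2 hgt)
        · exact ⟨d, hd, hdf⟩
      obtain ⟨s₁, s₂, z, -, h1, h2, h3, h4, h5, h6, h7, h8, h9, h10⟩ :=
        exists_split_chain hs hgt hex'
      refine ⟨(δ, g') :: s₁, s₂, z, by simp, ⟨hδ, hδ', h1⟩, h2, h3,
        by simpa [vels] using Or.inr h4, h5, ?_, ?_, ?_, ?_, ?_⟩
      · intro d hd
        simp only [vels, List.map_cons] at hd
        rcases List.mem_cons.1 hd with rfl | hd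
        · exact hgt.le
        · exact h6 d hd
      · simp only [duration]; linarith
      · simp only [disp, add_assoc, h8]
      · intro p
        have := h9 (p + (δ / 2) • (g + g'))
        simp only [area2, disp, ← add_assoc] at *
        linarith
      · intro e he
        have := h10 e fun d hd => he d (List.mem_cons_of_mem _ (by simpa [vels] using hd))
        refine ⟨fun d hd => ?_, this.2⟩
        simp only [vels, List.map_cons] at hd
        rcases List.mem_cons.1 hd with rfl | hd
        · exact he _ (by simp [vels])
        · exact this.1 d hd

lemma pairwise_first_of_isChain : ∀ (l : List (ℝ × ℝ)) (g : ℝ × ℝ), 0 < g.1 →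
    (∀ d ∈ l, 0 ≤ d.1) → (g :: l).IsChain (fun a b => 0 < cross a b) → ∀ d ∈ l, 0 < cross g d
  | [], _, _, _, _ => by simp
  | g' :: l, g, hg, hl, hc => by
    rw [List.isChain_cons_cons] at hc
    intro d hd
    rcases List.mem_cons.1 hd with rfl | hd
    · exact hc.1
    have hg' : 0 < g'.1 := by
      obtain ⟨x, l, rfl⟩ := List.exists_cons_of_ne_nil (List.ne_nil_of_mem hd)
      have h1 := hc.1
      have h2 := (List.isChain_cons_cons.1 hc.2).1
      have h3 := hl g' (by simp)
      have h4 := hl x (by simp)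
      simp only [cross] at h1 h2
      by_contra hcon
      have h0 : g'.1 = 0 := by linarith
      rw [h0] at h1 h2
      have : 0 < g'.2 := by
        by_contra h
        nlinarith [mul_nonneg hg.le (sub_nonneg.2 (not_lt.1 h))]
      nlinarith [mul_nonneg this.le h4]
    have ih := pairwise_first_of_isChain l g' hg' (fun x hx => hl x (List.mem_cons_of_mem _ hx))
      hc.2 d hd
    have h1 := hc.1
    have h3 := hl d (List.mem_cons_of_mem _ hd)
    simp only [cross] at *
    have e : g'.1 * (g.1 * d.2 - g.2 * d.1) =
        g.1 * (g'.1 * d.2 - g'.2 * d.1) + d.1 * (g.1 * g'.2 - g.2 * g'.1) := by ring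
    have : 0 < g'.1 * (g.1 * d.2 - g.2 * d.1) := by
      rw [e]
      have := mul_pos hg ih
      have := mul_nonneg h3 h1.le
      linarith
    exact pos_of_mul_pos_right this hg'.le

lemma disp_fst_nonneg : ∀ {s : List Step} {g : ℝ × ℝ}, IsConvexChain g s →
    (∀ d ∈ g :: vels s, 0 ≤ d.1) → 0 ≤ (disp g s).1
  | [], _, _, _ => by simp [disp]
  | (δ, g') :: s, g, h, hd => by
    have hd' : ∀ d ∈ g' :: vels s, 0 ≤ d.1 := fun d h => hd d (List.mem_cons_of_mem _ h)
    have := disp_fst_nonneg h.2.2 hd'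
    have h1 := hd g (by simp)
    have h2 := hd' g' (by simp)
    have := h.1
    simp only [disp, Prod.fst_add, Prod.smul_fst, smul_eq_mul]
    positivity

lemma cross_disp_pos {f : ℝ × ℝ} : ∀ {s : List Step} {g : ℝ × ℝ}, IsConvexChain g s → s ≠ [] →
    (∀ d ∈ g :: vels s, 0 < cross d f) → 0 < cross (disp g s) f
  | [], _, _, h, _ => absurd rfl h
  | (δ, g') :: s, g, h, _, hd => by
    have hd' : ∀ d ∈ g' :: vels s, 0 < cross d f := fun d h => hd d (List.mem_cons_of_mem _ h)
    have h1 := hd g (by simp)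
    have h2 := hd' g' (by simp)
    have := h.1
    have h3 : 0 ≤ cross (disp g' s) f := by
      by_cases hs : s = []
      · simp [hs, disp, cross]
      · exact (cross_disp_pos h.2.2 hs hd').le
    simp only [disp]
    rw [cross_add_left, cross_smul_left, cross_add_left]
    positivity

lemma lastVel_ne_zero : ∀ {s : List Step} {g : ℝ × ℝ}, IsConvexChain g s → s ≠ [] →
    lastVel g s ≠ 0
  | [], _, _, h => absurd rfl h
  | (δ, g') :: s, g, h, _ => by
    simp only [lastVel]
    by_cases hs : s = []
    · subst hs
      simp only [lastVel]
      rintro rfl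
      have := h.1.trans_le h.2.1
      rw [cross_zero_right] at this
      exact this.false
    · exact lastVel_ne_zero h.2.2 hs

/-- The affine isoperimetric inequality for a chain in a half-plane whose first velocity is parallel
to the boundary; `area2 0 g s` is twice the area between the chain and its chord. The chain is
divided where its velocity is parallel to the chord, and each part is an arc in a quadrant with
respect to the point of the chord that lies in the direction of the first velocity from the point of
division. -/
theorem IsConvexChain.half_duration_pow_three_le {s : List Step} {g : ℝ × ℝ}
    (h : IsConvexChain g s) (hne : s ≠ []) (hg : g.1 = 0) (hs : ∀ d ∈ vels s, 0 ≤ d.1) :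
    duration s ^ 3 ≤ Real.pi ^ 2 * area2 0 g s := by
  set D := disp g s with hD
  have hall : ∀ d ∈ g :: vels s, 0 ≤ d.1 := by
    intro d hd
    rcases List.mem_cons.1 hd with rfl | hd
    · exact hg.ge
    · exact hs d hd
  obtain ⟨hX, hgD⟩ : 0 < D.1 ∧ 0 < cross g D := by
    rw [hD]
    obtain ⟨⟨δ, g'⟩, s, rfl⟩ := List.exists_cons_of_ne_nil hne
    have h1 := h.1.trans_le h.2.1
    have h2 := hs g' (by simp [vels])
    simp only [cross, hg] at h1
    have h3 : 0 < g'.1 ∧ g.2 < 0 := by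
      constructor
      · by_contra hc
        have : g'.1 = 0 := by linarith
        rw [this] at h1; simp at h1
      · by_contra hc
        nlinarith [mul_nonneg (not_lt.1 hc) h2]
    have h4 := disp_fst_nonneg h.2.2 fun d hd => hs d (by simpa [vels] using hd)
    have h5 : 0 < (disp g ((δ, g') :: s)).1 := by
      have := h.1
      simp only [disp, Prod.fst_add, Prod.smul_fst, smul_eq_mul, hg]
      nlinarith [mul_pos this h3.1]
    refine ⟨h5, ?_⟩
    simp only [cross, hg]
    nlinarith [mul_pos h5 (neg_pos.2 h3.2)]
  have hex : ∃ d ∈ vels s, cross d D ≤ 0 := by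
    by_contra hcon
    push Not at hcon
    have := cross_disp_pos (f := D) h hne (by
      intro d hd
      rcases List.mem_cons.1 hd with rfl | hd
      · exact hgD
      · exact hcon d hd)
    rw [← hD, cross_self] at this
    exact this.false
  obtain ⟨s₁, s₂, z, hne1, hc1, hlast, hc2, hzmem, hzD, hpos1, hdur, hdisp, harea, hpos⟩ :=
    exists_split_chain h hgD hex
  have hξ := hpos (0, 1) fun d hd => by simpa [cross] using hall d hd
  have hξ1 : ∀ d ∈ g :: vels s₁, 0 ≤ d.1 := by
    intro d hd
    rcases List.mem_cons.1 hd with rfl | hd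
    · exact hg.ge
    · simpa [cross] using hξ.1 d hd
  have hξ2 : ∀ d ∈ vels s₂, 0 ≤ d.1 := fun d hd => by simpa [cross] using hξ.2 d hd
  have hz0 : 0 ≤ z.1 := hξ1 z (List.mem_cons_of_mem _ hzmem)
  have hzne : z ≠ 0 := hlast ▸ lastVel_ne_zero hc1 hne1
  have hz1 : 0 < z.1 := by
    by_contra hcon
    have h0 : z.1 = 0 := by linarith
    have h1 : z.2 = 0 := by
      simp only [cross, h0] at hzD
      have : z.2 * D.1 = 0 := by linarith
      exact (mul_eq_zero.1 this).resolve_right hX.ne'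
    exact hzne (Prod.ext h0 h1)
  have hneg2 : ∀ d ∈ z :: vels s₂, cross d D ≤ 0 := by
    intro d hd
    rcases List.mem_cons.1 hd with rfl | hd
    · exact hzD.le
    have h1 := pairwise_first_of_isChain _ z hz1 hξ2 hc2.isChain d hd
    simp only [cross] at h1 hzD ⊢
    -- `D` is a positive multiple of `z`
    have e : z.1 * (d.1 * D.2 - d.2 * D.1) =
        d.1 * (z.1 * D.2 - z.2 * D.1) - D.1 * (z.1 * d.2 - z.2 * d.1) := by ring
    rw [hzD, mul_zero, zero_sub] at e
    have := mul_pos hX h1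
    by_contra hcon
    have := mul_pos hz1 (not_le.1 hcon)
    linarith
  set l : ℝ := (disp g s₁).1 / D.1 with hl
  have hlD : l * D.1 = (disp g s₁).1 := div_mul_cancel₀ _ hX.ne'
  let φ₁ : ℝ × ℝ →ₗ[ℝ] ℝ × ℝ :=
    { toFun := fun w => (-w.1, cross w D / D.1)
      map_add' := fun a b => by ext <;> simp [cross] <;> ring
      map_smul' := fun r a => by ext <;> simp [cross]; ring }
  let φ₂ : ℝ × ℝ →ₗ[ℝ] ℝ × ℝ :=
    { toFun := fun w => (cross w D / D.1, w.1)
      map_add' := fun a b => by ext <;> simp [cross]; ring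
      map_smul' := fun r a => by ext <;> simp [cross]; ring }
  have hφ₁ : ∀ w, φ₁ w = (-w.1, cross w D / D.1) := fun _ => rfl
  have hφ₂ : ∀ w, φ₂ w = (cross w D / D.1, w.1) := fun _ => rfl
  have hcr₁ : ∀ a b, cross (φ₁ a) (φ₁ b) = cross a b := by
    intro a b
    rw [hφ₁, hφ₁]
    simp only [cross]
    field_simp
    ring
  have hcr₂ : ∀ a b, cross (φ₂ a) (φ₂ b) = cross a b := by
    intro a b
    rw [hφ₂, hφ₂]
    simp only [cross]
    field_simp
    ring
  have A1 : duration s₁ ^ 3 ≤ Real.pi ^ 2 / 4 * area2 (-(l • D)) g s₁ := by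
    rw [← duration_mapSteps (φ := φ₁), ← area2_mapSteps hcr₁]
    apply IsConvexChain.duration_pow_three_le ((isConvexChain_mapSteps hcr₁ _ _).2 hc1)
    · simpa [mapSteps] using hne1
    · rw [vels_mapSteps, ← List.map_cons]
      intro d hd
      obtain ⟨w, hw, rfl⟩ := List.mem_map.1 hd
      rw [hφ₁]
      refine ⟨neg_nonpos.2 (hξ1 w hw), div_nonneg ?_ hX.le⟩
      rcases List.mem_cons.1 hw with rfl | hw
      · exact hgD.le
      · exact hpos1 w hw
    · rw [hφ₁]
      simp [cross, mul_comm, mul_left_comm]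
    · rw [disp_mapSteps, ← map_add, hφ₁]
      simp [hlD]
  have A2 : duration s₂ ^ 3 ≤ Real.pi ^ 2 / 4 * area2 (-(l • D) + disp g s₁) z s₂ := by
    by_cases hne2 : s₂ = []
    · simp [hne2, duration, area2]
    rw [← duration_mapSteps (φ := φ₂), ← area2_mapSteps hcr₂]
    apply IsConvexChain.duration_pow_three_le ((isConvexChain_mapSteps hcr₂ _ _).2 hc2)
    · simpa [mapSteps] using hne2
    · rw [vels_mapSteps, ← List.map_cons]
      intro d hd
      obtain ⟨w, hw, rfl⟩ := List.mem_map.1 hd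
      rw [hφ₂]
      refine ⟨div_nonpos_of_nonpos_of_nonneg (hneg2 w hw) hX.le, ?_⟩
      rcases List.mem_cons.1 hw with rfl | hw
      · exact hz0
      · exact hξ2 w hw
    · rw [hφ₂]
      simp [hlD]
    · rw [disp_mapSteps, ← map_add, hφ₂, add_assoc, hdisp, ← hD,
        cross_add_left, ← neg_smul, cross_smul_left, cross_self]
      simp
  have hA : area2 (-(l • D)) g s = area2 0 g s := by
    have := area2_add (-(l • D)) s 0 g
    rw [zero_add, ← hD] at this
    rw [this, ← neg_smul, cross_smul_left, cross_self]
    simp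
  have h3 := harea (-(l • D))
  rw [hA] at h3
  have d1 := hc1.duration_nonneg
  have d2 := hc2.duration_nonneg
  rw [← hdur]
  set x := duration s₁
  set y := duration s₂
  have hcube : (x + y) ^ 3 ≤ 4 * (x ^ 3 + y ^ 3) := by
    nlinarith [mul_nonneg (add_nonneg d1 d2) (sq_nonneg (x - y))]
  have hpi : 0 ≤ Real.pi ^ 2 := sq_nonneg _
  have h4 := mul_le_mul_of_nonneg_left h3 hpi
  linarith

/-! ### The affine isoperimetric inequality for convex polygons -/

/-- The chain of steps of duration one with given velocities. -/
def unitSteps (l : List (ℝ × ℝ)) : List Step := l.map fun g => (1, g)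

lemma duration_unitSteps (l : List (ℝ × ℝ)) : duration (unitSteps l) = l.length := by
  induction l with
  | nil => simp [unitSteps, duration]
  | cons g l ih =>
    simp only [unitSteps] at ih
    simp [unitSteps, duration, ih, add_comm]

lemma vels_unitSteps (l : List (ℝ × ℝ)) : vels (unitSteps l) = l := by
  simp [vels, unitSteps, Function.comp_def]

lemma lastVel_mem : ∀ (s : List Step) (g : ℝ × ℝ), lastVel g s ∈ g :: vels s
  | [], g => by simp [lastVel]
  | (_, g') :: s, g => by
    have := lastVel_mem s g'
    simp only [lastVel, vels, List.map_cons] at *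
    exact List.mem_cons_of_mem _ this

/-- A closed chain which first moves to the right and then to the left is divided at the two
velocities parallel to the vertical axis. -/
lemma closed_chain_pow_three_le {a b : ℝ × ℝ} {L₁ L₂ : List (ℝ × ℝ)}
    (hc : IsConvexChain a (unitSteps L₁ ++ (1, b) :: (unitSteps L₂ ++ [(1, a)])))
    (h1 : ∀ d ∈ a :: L₁, 0 < d.1) (h2 : ∀ d ∈ b :: L₂, d.1 < 0)
    (hclosed : disp a (unitSteps L₁ ++ (1, b) :: (unitSteps L₂ ++ [(1, a)])) = 0) (p : ℝ × ℝ) :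
    ((L₁.length + L₂.length + 2 : ℕ) : ℝ) ^ 3 ≤ 4 * Real.pi ^ 2 *
      area2 p a (unitSteps L₁ ++ (1, b) :: (unitSteps L₂ ++ [(1, a)])) := by
  have hp : area2 p a (unitSteps L₁ ++ (1, b) :: (unitSteps L₂ ++ [(1, a)])) =
      area2 0 a (unitSteps L₁ ++ (1, b) :: (unitSteps L₂ ++ [(1, a)])) := by
    have := area2_add p (unitSteps L₁ ++ (1, b) :: (unitSteps L₂ ++ [(1, a)])) 0 a
    rw [zero_add, hclosed, cross_zero_right, add_zero] at this
    exact this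
  rw [hp]
  set c := lastVel a (unitSteps L₁) with hcdef
  set e := lastVel b (unitSteps L₂) with hedef
  have hc1 : 0 < c.1 := h1 _ (by simpa [vels_unitSteps] using lastVel_mem (unitSteps L₁) a)
  have he1 : e.1 < 0 := h2 _ (by simpa [vels_unitSteps] using lastVel_mem (unitSteps L₂) b)
  obtain ⟨k1, k2, k3, k4⟩ := (isConvexChain_append _ _ _).1 hc
  obtain ⟨k5, -, k6, -⟩ := (isConvexChain_append _ _ _).1 k4
  rw [← hcdef] at k3
  rw [← hedef] at k6
  obtain ⟨z, t, t', hz, ht, ht', htt, htz, htz', -, hdz, haz⟩ :=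
    exists_split_step (f := (0, 1)) one_pos k3 (by simpa [cross] using hc1)
      (by simpa [cross] using h2 b (by simp))
  obtain ⟨y, r, r', hy, hr, hr', hrr, hry, hry', -, hdy, hay⟩ :=
    exists_split_step (f := (0, -1)) one_pos k6 (by simpa [cross] using he1)
      (by simpa [cross] using h1 a (by simp))
  have hz1 : z.1 = 0 := by simpa [cross] using hz
  have hy1 : y.1 = 0 := by simpa [cross] using hy
  set P := unitSteps L₁ ++ [(t, z)] with hP
  set H := (t', b) :: (unitSteps L₂ ++ [(r, y)]) with hH
  have hlP : lastVel a P = z := by simp [hP, lastVel_append, lastVel]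
  have hlH : lastVel z H = y := by simp [hH, lastVel_append, lastVel]
  have cP : IsConvexChain a P := (isConvexChain_append _ _ _).2 ⟨k1, ht, htz, trivial⟩
  have cH : IsConvexChain z H :=
    ⟨ht', htz', (isConvexChain_append _ _ _).2 ⟨k5, hr, hry, trivial⟩⟩
  have cQ : IsConvexChain y ((r', a) :: P) := ⟨hr', hry', cP⟩
  have hdisp : disp a P + disp z H + (r' / 2) • (y + a) = 0 := by
    rw [← hclosed, hP, hH, disp_append, disp_append]
    simp only [disp, disp_append, add_zero, ← hcdef, ← hedef]
    rw [← hdz, ← hdy]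
    abel
  have harea : area2 0 a P + area2 (disp a P) z H +
      area2 (disp a P + disp z H) y [(r', a)] ≤
      area2 0 a (unitSteps L₁ ++ (1, b) :: (unitSteps L₂ ++ [(1, a)])) := by
    have e1 := haz (0 + disp a (unitSteps L₁))
    have e2 := hay (0 + disp a (unitSteps L₁) + (1 / 2 : ℝ) • (c + b) + disp b (unitSteps L₂))
    rw [hP, hH]
    simp only [area2_append, disp_append, area2, disp, add_zero, ← hcdef, ← hedef,
      zero_add] at e1 e2 ⊢
    rw [← hdz] at e2 ⊢
    simp only [← add_assoc] at e1 e2 ⊢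
    linarith
  have key : area2 0 y ((r', a) :: P) + area2 0 z H ≤
      area2 0 a (unitSteps L₁ ++ (1, b) :: (unitSteps L₂ ++ [(1, a)])) := by
    refine le_trans (le_of_eq ?_) harea
    set d := (r' / 2) • (y + a) with hd
    have e1 : disp a P + disp z H = -d := eq_neg_of_add_eq_zero_left hdisp
    have e2 : disp a P = -d - disp z H := by rw [← e1]; abel
    have e3 : area2 (-d) y ((r', a) :: P) = area2 (-d) y [(r', a)] + area2 0 a P := by
      simp only [area2, ← hd, neg_add_cancel, add_zero]
    have e4 : area2 (-d) y ((r', a) :: P) = area2 0 y ((r', a) :: P) +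
        cross (-d) (disp y ((r', a) :: P)) := by
      rw [← area2_add, zero_add]
    have e5 : disp y ((r', a) :: P) = - disp z H := by
      simp only [disp, ← hd, e2]; abel
    have e6 : area2 (disp a P) z H = area2 0 z H + cross (disp a P) (disp z H) := by
      rw [← area2_add, zero_add]
    have e7 : cross (-d) (- disp z H) + cross d (disp z H) = 2 * cross d (disp z H) := by
      simp only [cross, Prod.fst_neg, Prod.snd_neg]; ring
    have e8 : cross (disp a P) (disp z H) = - cross d (disp z H) := by
      rw [e2]; simp only [cross, Prod.fst_neg, Prod.snd_neg, Prod.fst_sub, Prod.snd_sub]; ring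
    rw [e6, e1]
    rw [e5] at e4
    linarith
  have A1 : duration ((r', a) :: P) ^ 3 ≤ Real.pi ^ 2 * area2 0 y ((r', a) :: P) := by
    apply cQ.half_duration_pow_three_le (by simp) hy1
    intro d hd
    simp only [hP, vels, List.map_cons, List.map_append, List.map_nil] at hd
    rcases List.mem_cons.1 hd with rfl | hd
    · exact (h1 _ (by simp)).le
    rcases List.mem_append.1 hd with hd | hd
    · exact (h1 d (List.mem_cons_of_mem _ (by simpa [unitSteps] using hd))).le
    · rw [List.mem_singleton.1 hd, hz1]
  have A2 : duration H ^ 3 ≤ Real.pi ^ 2 * area2 0 z H := by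
    let φ : ℝ × ℝ →ₗ[ℝ] ℝ × ℝ := -LinearMap.id
    have hcr : ∀ a b, cross (φ a) (φ b) = cross a b := by intro a b; simp [φ, cross]
    rw [← duration_mapSteps (φ := φ), ← area2_mapSteps hcr, map_zero]
    apply ((isConvexChain_mapSteps hcr _ _).2 cH).half_duration_pow_three_le
    · simp [hH, mapSteps]
    · simp [φ, hz1]
    · rw [vels_mapSteps]
      intro d hd
      obtain ⟨w, hw, rfl⟩ := List.mem_map.1 hd
      have : w.1 ≤ 0 := by
        simp only [hH, vels, List.map_cons, List.map_append, List.map_nil] at hw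
        rcases List.mem_cons.1 hw with rfl | hw
        · exact (h2 _ (by simp)).le
        rcases List.mem_append.1 hw with hw | hw
        · exact (h2 w (List.mem_cons_of_mem _ (by simpa [unitSteps] using hw))).le
        · rw [List.mem_singleton.1 hw, hy1]
      simpa [φ] using this
  have hdur : ((L₁.length + L₂.length + 2 : ℕ) : ℝ) = duration ((r', a) :: P) + duration H := by
    simp only [hP, hH, duration, duration_append, duration_unitSteps]
    push_cast
    linarith
  have d1 := cQ.duration_nonneg
  have d2 := cH.duration_nonneg
  rw [hdur]
  set x := duration ((r', a) :: P)
  set w := duration H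
  have hcube : (x + w) ^ 3 ≤ 4 * (x ^ 3 + w ^ 3) := by
    nlinarith [mul_nonneg (add_nonneg d1 d2) (sq_nonneg (x - w))]
  have h4 := mul_le_mul_of_nonneg_left key (sq_nonneg Real.pi)
  linarith

section polygon
variable (v : ℕ → ℝ × ℝ)

lemma isConvexChain_edges (m : ℕ) : ∀ i,
    (∀ j, i ≤ j → j < i + m → 1 ≤ cross (v (j + 1) - v j) (v (j + 2) - v (j + 1))) →
    IsConvexChain (v (i + 1) - v i)
      (unitSteps ((List.range' (i + 1) m).map fun j => v (j + 1) - v j)) := by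
  induction m with
  | zero => simp [unitSteps, IsConvexChain]
  | succ m ih =>
    intro i h
    simp only [List.range'_succ, List.map_cons, unitSteps, IsConvexChain]
    exact ⟨one_pos, h i le_rfl (by omega), ih (i + 1) fun j hj hj' => h j (by omega) (by omega)⟩

lemma disp_edges (m : ℕ) : ∀ i, disp (v (i + 1) - v i)
      (unitSteps ((List.range' (i + 1) m).map fun j => v (j + 1) - v j)) =
    (1 / 2 : ℝ) • (v (i + m) + v (i + m + 1)) - (1 / 2 : ℝ) • (v i + v (i + 1)) := by
  induction m with
  | zero => simp [unitSteps, disp]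
  | succ m ih =>
    intro i
    have := ih (i + 1)
    simp only [unitSteps] at this
    simp only [List.range'_succ, List.map_cons, unitSteps, disp, this]
    rw [show i + 1 + m = i + (m + 1) by ring]
    ext <;> simp <;> ring

/-- The shoelace formula, for a chain that starts in the middle of an edge. -/
lemma area2_edges (m : ℕ) : ∀ i, area2 ((1 / 2 : ℝ) • (v i + v (i + 1))) (v (i + 1) - v i)
      (unitSteps ((List.range' (i + 1) m).map fun j => v (j + 1) - v j)) =
    ∑ j ∈ Finset.range m, (cross (v (i + j)) (v (i + j + 1)) / 2 +
      cross (v (i + j + 1)) (v (i + j + 2)) / 2) := by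
  induction m with
  | zero => simp [unitSteps, area2]
  | succ m ih =>
    intro i
    have := ih (i + 1)
    simp only [unitSteps] at this
    rw [Finset.sum_range_succ']
    simp only [List.range'_succ, List.map_cons, unitSteps, area2]
    have e : (1 / 2 : ℝ) • (v i + v (i + 1)) + (1 / 2 : ℝ) • (v (i + 1) - v i +
        (v (i + 1 + 1) - v (i + 1))) = (1 / 2 : ℝ) • (v (i + 1) + v (i + 1 + 1)) := by
      ext <;> simp <;> ring
    rw [e, this, add_comm]
    congr 1
    · refine Finset.sum_congr rfl fun j _ => ?_
      rw [show i + 1 + j = i + (j + 1) by ring]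
    · simp only [cross, Prod.fst_add, Prod.snd_add, Prod.smul_fst, Prod.smul_snd, smul_eq_mul,
        Prod.fst_sub, Prod.snd_sub, add_zero]
      ring

/-- A closed polygon with `n` vertices which first moves to the right and then to the left, and
whose consecutive edges have determinant at least one, has area at least `n ^ 3 / (8 π ^ 2)`. -/
theorem card_pow_three_le_area {n r : ℕ} (hr : 0 < r) (hrn : r < n) (hv : v n = v 0)
    (hv' : v (n + 1) = v 1)
    (hcorner : ∀ i < n, 1 ≤ cross (v (i + 1) - v i) (v (i + 2) - v (i + 1)))
    (hinc : ∀ i < r, (v i).1 < (v (i + 1)).1)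
    (hdec : ∀ i, r ≤ i → i < n → (v (i + 1)).1 < (v i).1) :
    (n : ℝ) ^ 3 ≤ 4 * Real.pi ^ 2 * ∑ i ∈ Finset.range n, cross (v i) (v (i + 1)) := by
  set a : ℕ → ℝ × ℝ := fun j => v (j + 1) - v j with ha
  have hlist : unitSteps ((List.range' (0 + 1) n).map a) =
      unitSteps ((List.range' 1 (r - 1)).map a) ++ (1, a r) ::
        (unitSteps ((List.range' (r + 1) (n - 1 - r)).map a) ++ [(1, a 0)]) := by
    have e0 : a n = a 0 := by simp only [ha, hv, hv', zero_add]
    have e1 : List.range' (0 + 1) n =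
        List.range' 1 (r - 1) ++ r :: (List.range' (r + 1) (n - 1 - r) ++ [n]) := by
      have h1 : List.range' 1 (r - 1) ++ List.range' (1 + (r - 1)) (1 + (n - 1 - r + 1)) =
          List.range' 1 (r - 1 + (1 + (n - 1 - r + 1))) := List.range'_append_1
      have h2 : List.range' (r + 1) (n - 1 - r) ++ List.range' (r + 1 + (n - 1 - r)) 1 =
          List.range' (r + 1) (n - 1 - r + 1) := List.range'_append_1
      rw [show r - 1 + (1 + (n - 1 - r + 1)) = n by omega, show 1 + (r - 1) = r by omega,
        add_comm 1 (n - 1 - r + 1), List.range'_succ] at h1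
      rw [show r + 1 + (n - 1 - r) = n by omega] at h2
      rw [zero_add, ← h1, ← h2]
      simp
    rw [e1]
    simp [unitSteps, e0]
  have hchain := isConvexChain_edges v n 0 fun j _ hj => hcorner j (by omega)
  have hdisp := disp_edges v n 0
  have harea := area2_edges v n 0
  simp only [← ha] at hchain hdisp harea
  change IsConvexChain (a 0) _ at hchain
  change disp (a 0) _ = _ at hdisp
  change area2 _ (a 0) _ = _ at harea
  rw [hlist] at hchain hdisp harea
  have := closed_chain_pow_three_le hchain ?_ ?_ ?_ ((1 / 2 : ℝ) • (v 0 + v (0 + 1)))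
  · rw [harea] at this
    have hn : (List.map a (List.range' 1 (r - 1))).length +
        (List.map a (List.range' (r + 1) (n - 1 - r))).length + 2 = n := by
      simp; omega
    rw [hn] at this
    refine this.trans_eq ?_
    congr 1
    rw [Finset.sum_add_distrib, ← Finset.sum_div, ← Finset.sum_div]
    have e : ∑ j ∈ Finset.range n, cross (v (0 + j + 1)) (v (0 + j + 2)) =
        ∑ j ∈ Finset.range n, cross (v j) (v (j + 1)) := by
      have h1 := Finset.sum_range_succ' (fun j => cross (v j) (v (j + 1))) n
      have h2 := Finset.sum_range_succ (fun j => cross (v j) (v (j + 1))) n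
      rw [hv, hv'] at h2
      simp only [zero_add] at h1 ⊢
      linarith
    rw [e]
    simp only [zero_add]
    ring
  · intro d hd
    have : ∃ i < r, d = a i := by
      rcases List.mem_cons.1 hd with rfl | hd
      · exact ⟨0, hr, rfl⟩
      · obtain ⟨i, hi, rfl⟩ := List.mem_map.1 hd
        rw [List.mem_range'_1] at hi
        exact ⟨i, by omega, rfl⟩
    obtain ⟨i, hi, rfl⟩ := this
    simpa [ha] using hinc i hi
  · intro d hd
    have : ∃ i, r ≤ i ∧ i < n ∧ d = a i := by
      rcases List.mem_cons.1 hd with rfl | hd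
      · exact ⟨r, le_rfl, hrn, rfl⟩
      · obtain ⟨i, hi, rfl⟩ := List.mem_map.1 hd
        rw [List.mem_range'_1] at hi
        exact ⟨i, by omega, by omega, rfl⟩
    obtain ⟨i, hi, hi', rfl⟩ := this
    simpa [ha] using hdec i hi hi'
  · rw [hdisp]
    simp [hv, hv']
end polygon

/-! ### Lattice points in fans of triangles -/

/-- The determinant of two lattice vectors. -/
def icross (a b : ℤ × ℤ) : ℤ := a.1 * b.2 - a.2 * b.1

/-- The inclusion of the lattice into the plane. -/
def toPlane (x : ℤ × ℤ) : ℝ × ℝ := ((x.1 : ℝ), (x.2 : ℝ))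

lemma cross_toPlane (a b : ℤ × ℤ) : cross (toPlane a) (toPlane b) = (icross a b : ℤ) := by
  simp [cross, icross, toPlane]

/-- Cramer's rule. -/
lemma icross_smul_eq (a b x : ℤ × ℤ) :
    icross a b • x = icross x b • a + icross a x • b := by
  ext <;> simp [icross] <;> ring

/-- The triangle with vertices `0, a, b` without its edge from `0` to `a`. -/
def halfOpenTriangle (a b : ℤ × ℤ) : Set (ℤ × ℤ) :=
  {x | 0 ≤ icross x b ∧ 0 < icross a x ∧ icross x b + icross a x ≤ icross a b}

lemma finite_parallelogram {a b : ℤ × ℤ} (h : 0 < icross a b) :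
    {x | 0 ≤ icross x b ∧ icross x b ≤ icross a b ∧ 0 ≤ icross a x ∧
      icross a x ≤ icross a b}.Finite := by
  have hinj : Function.Injective fun x : ℤ × ℤ => (icross x b, icross a x) := by
    intro x y hxy
    simp only [Prod.mk.injEq] at hxy
    have h1 := icross_smul_eq a b x
    rw [hxy.1, hxy.2, ← icross_smul_eq a b y] at h1
    exact smul_right_injective _ h.ne' h1
  refine Set.Finite.subset (Set.Finite.preimage hinj.injOn
    (((Set.finite_Icc 0 (icross a b)).prod (Set.finite_Icc 0 (icross a b))))) ?_
  rintro x ⟨h1, h2, h3, h4⟩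
  exact ⟨⟨h1, h2⟩, h3, h4⟩

lemma finite_halfOpenTriangle {a b : ℤ × ℤ} (h : 0 < icross a b) :
    (halfOpenTriangle a b).Finite := by
  refine (finite_parallelogram h).subset ?_
  rintro x ⟨h1, h2, h3⟩
  exact ⟨h1, by linarith, h2.le, by linarith⟩

/-- The number of lattice points on the half-open segment from `0` to `a`. -/
def content (a : ℤ × ℤ) : ℕ := Int.gcd a.1 a.2

lemma content_pos {a : ℤ × ℤ} (h : a ≠ 0) : 0 < content a := by
  rw [content, Int.gcd_pos_iff]
  by_contra hcon
  push Not at hcon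
  exact h (Prod.ext hcon.1 hcon.2)

lemma exists_primitive {a : ℤ × ℤ} (h : a ≠ 0) :
    ∃ a' c : ℤ × ℤ, a = (content a : ℤ) • a' ∧ icross a' c = 1 := by
  have hg := content_pos h
  obtain ⟨x, hx⟩ : (content a : ℤ) ∣ a.1 := Int.gcd_dvd_left ..
  obtain ⟨y, hy⟩ : (content a : ℤ) ∣ a.2 := Int.gcd_dvd_right ..
  refine ⟨(x, y), (-Int.gcdB a.1 a.2, Int.gcdA a.1 a.2), Prod.ext (by simpa using hx)
    (by simpa using hy), ?_⟩
  have hb := Int.gcd_eq_gcd_ab a.1 a.2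
  change (content a : ℤ) = _ at hb
  have hg' : (content a : ℤ) ≠ 0 := by exact_mod_cast hg.ne'
  apply mul_left_cancel₀ hg'
  simp only [icross]
  calc (content a : ℤ) * (x * Int.gcdA a.1 a.2 - y * -Int.gcdB a.1 a.2)
      = ((content a : ℤ) * x) * Int.gcdA a.1 a.2 + ((content a : ℤ) * y) * Int.gcdB a.1 a.2 := by
        ring
    _ = content a * 1 := by rw [← hx, ← hy, ← hb, mul_one]

lemma exists_coords {a' c : ℤ × ℤ} (h : icross a' c = 1) (x : ℤ × ℤ) :
    x = icross a' x • c + icross x c • a' := by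
  have := icross_smul_eq a' c x
  rw [h, one_smul, add_comm] at this
  exact this

/-- A half-open lattice parallelogram contains at least as many lattice points as its area. -/
lemma icross_le_ncard_parallelogram {a b : ℤ × ℤ} (h : 0 < icross a b) :
    icross a b ≤ ({x | 0 ≤ icross x b ∧ icross x b < icross a b ∧ 0 < icross a x ∧
      icross a x ≤ icross a b}.ncard : ℤ) := by
  have ha : a ≠ 0 := by
    rintro rfl
    simp [icross] at h
  obtain ⟨a', c, hac, hc⟩ := exists_primitive ha
  have hgpos := content_pos ha
  set g := content a
  -- In the basis `c, a'` the parallelogram is a stack of rows of `g` points.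
  set k := icross a' b with hk
  set l := icross b c with hl
  have hb : b = k • c + l • a' := exists_coords hc b
  have hd : icross a b = g * k := by
    rw [hac, hk]; simp [icross]; ring
  have hg0 : (0 : ℤ) < g := by exact_mod_cast hgpos
  have hk0 : 0 < k := by
    rw [hd] at h
    exact pos_of_mul_pos_right h hg0.le
  let F : ℤ × ℤ → ℤ × ℤ := fun p => p.1 • c + (-((-(p.1 * l)) / k) + p.2) • a'
  have hF1 : ∀ p, icross a (F p) = g * p.1 := by
    intro p
    have : icross a (F p) = g * p.1 * icross a' c := by
      simp only [F]; rw [hac]; simp [icross]; ring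
    rw [this, hc, mul_one]
  have hF2 : ∀ p, icross (F p) b = (-(p.1 * l)) % k + p.2 * k := by
    intro p
    have e := Int.emod_add_mul_ediv (-(p.1 * l)) k
    have : icross (F p) b = ((-((-(p.1 * l)) / k) + p.2) * k - p.1 * l) * icross a' c := by
      rw [hb]; simp only [F]; simp [icross]; ring
    rw [this, hc, mul_one]
    linarith
  have hF3 : ∀ p, icross (F p) c = -((-(p.1 * l)) / k) + p.2 := by
    intro p
    have : icross (F p) c = (-((-(p.1 * l)) / k) + p.2) * icross a' c := by
      simp only [F]; simp [icross]; ring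
    rw [this, hc, mul_one]
  have hinj : Function.Injective F := by
    intro p q hpq
    have h1 : p.1 = q.1 := by
      have := hF1 p
      rw [hpq, hF1] at this
      exact (mul_left_cancel₀ hg0.ne' this).symm
    have h2 := hF3 p
    rw [hpq, hF3, h1] at h2
    exact Prod.ext h1 (by linarith)
  have hsub : (((Finset.Icc 1 k ×ˢ Finset.Ico 0 (g : ℤ)).image F : Finset (ℤ × ℤ)) : Set (ℤ × ℤ)) ⊆
      {x | 0 ≤ icross x b ∧ icross x b < icross a b ∧ 0 < icross a x ∧
      icross a x ≤ icross a b} := by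
    intro x hx
    simp only [Finset.coe_image, Set.mem_image, Finset.mem_coe, Finset.mem_product,
      Finset.mem_Icc, Finset.mem_Ico] at hx
    obtain ⟨p, ⟨⟨h1, h2⟩, h3, h4⟩, rfl⟩ := hx
    have m1 := Int.emod_nonneg (-(p.1 * l)) hk0.ne'
    have m2 := Int.emod_lt_of_pos (-(p.1 * l)) hk0
    rw [Set.mem_ofPred_eq, hF1, hF2, hd]
    refine ⟨by positivity, ?_, by positivity, by gcongr⟩
    nlinarith [mul_le_mul_of_nonneg_right (show p.2 + 1 ≤ (g : ℤ) by linarith) hk0.le]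
  have hcard := Set.ncard_le_ncard hsub ((finite_parallelogram h).subset
    fun x hx => ⟨hx.1, hx.2.1.le, hx.2.2.1.le, hx.2.2.2⟩)
  rw [Set.ncard_coe_finset, Finset.card_image_of_injective _ hinj, Finset.card_product,
    Int.card_Icc, Int.card_Ico] at hcard
  have : ((k + 1 - 1).toNat * ((g : ℤ) - 0).toNat : ℕ) = (g * k : ℤ) := by
    push_cast
    rw [Int.toNat_of_nonneg (by linarith), Int.toNat_of_nonneg (by linarith)]
    ring
  calc icross a b = ((k + 1 - 1).toNat * ((g : ℤ) - 0).toNat : ℕ) := by rw [hd, this]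
    _ ≤ _ := Int.ofNat_le.2 hcard

/-- Pick's inequality for a half-open triangle. The half-open parallelogram consists of
the triangle and a reflected copy of a part of it. -/
lemma le_two_mul_ncard_halfOpenTriangle {a b : ℤ × ℤ} (h : 0 < icross a b) :
    icross a b + content b + 1 ≤ 2 * ((halfOpenTriangle a b).ncard : ℤ) + content a := by
  have ha : a ≠ 0 := by
    rintro rfl
    simp [icross] at h
  have hb : b ≠ 0 := by
    rintro rfl
    simp [icross] at h
  set d := icross a b with hd
  set P : Set (ℤ × ℤ) := {x | 0 ≤ icross x b ∧ icross x b < d ∧ 0 < icross a x ∧ icross a x ≤ d}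
    with hP
  set I : Set (ℤ × ℤ) := {x | 0 < icross x b ∧ 0 < icross a x ∧ icross x b + icross a x < d} with hI
  set E : Set (ℤ × ℤ) := {x | 0 < icross x b ∧ icross a x = 0 ∧ icross x b < d} with hE
  have hTfin := finite_halfOpenTriangle h
  have hIfin : I.Finite := hTfin.subset fun x hx => ⟨hx.1.le, hx.2.1, hx.2.2.le⟩
  have hEfin : E.Finite := (finite_parallelogram h).subset
    fun x hx => ⟨hx.1.le, hx.2.2.le, hx.2.1.ge, by rw [hx.2.1]; exact h.le⟩
  have hPcard : d ≤ P.ncard := icross_le_ncard_parallelogram h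
  have hPsub : P ⊆ halfOpenTriangle a b ∪ (fun x => a + b - x) '' (I ∪ E) := by
    rintro x ⟨h1, h2, h3, h4⟩
    rcases le_or_gt (icross x b + icross a x) d with hle | hgt
    · exact Or.inl ⟨h1, h3, hle⟩
    · right
      refine ⟨a + b - x, ?_, by simp⟩
      have e1 : icross (a + b - x) b = d - icross x b := by
        rw [hd]; simp [icross]; ring
      have e2 : icross a (a + b - x) = d - icross a x := by
        rw [hd]; simp [icross]; ring
      rcases h4.eq_or_lt with h4 | h4
      · right
        refine ⟨?_, ?_, ?_⟩ <;> simp only [e1, e2] <;> linarith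
      · left
        refine ⟨?_, ?_, ?_⟩ <;> simp only [e1, e2] <;> linarith
  have hPle : P.ncard ≤ (halfOpenTriangle a b).ncard + (I.ncard + E.ncard) := by
    have hfin := (hIfin.union hEfin).image (fun x => a + b - x)
    calc P.ncard ≤ _ := Set.ncard_le_ncard hPsub (hTfin.union hfin)
      _ ≤ _ := Set.ncard_union_le _ _
      _ ≤ (halfOpenTriangle a b).ncard + (I ∪ E).ncard := by
        exact Nat.add_le_add_left (Set.ncard_image_le (hIfin.union hEfin)) _
      _ ≤ _ := by
        exact Nat.add_le_add_left (Set.ncard_union_le _ _) _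
  have hEle : E.ncard + 1 ≤ content a := by
    obtain ⟨a', c, hac, hc⟩ := exists_primitive ha
    have hgpos := content_pos ha
    set g := content a
    have hg0 : (0 : ℤ) < g := by exact_mod_cast hgpos
    have hdk : d = g * icross a' b := by
      rw [hd, hac]; simp [icross]; ring
    have hk0 : 0 < icross a' b := by
      rw [hdk] at h
      exact pos_of_mul_pos_right h hg0.le
    have hsub : E ⊆ (((Finset.Ioo 0 (g : ℤ)).image fun j => j • a' : Finset (ℤ × ℤ)) :
        Set (ℤ × ℤ)) := by
      rintro x ⟨h1, h2, h3⟩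
      have e : icross a' x = 0 := by
        have : icross a x = g * icross a' x := by
          rw [hac]; simp [icross]; ring
        rw [this] at h2
        exact (mul_eq_zero.1 h2).resolve_left hg0.ne'
      have hx : x = icross x c • a' := by
        have := exists_coords hc x
        rw [e, zero_smul, zero_add] at this
        exact this
      set j := icross x c
      have e2 : icross x b = j * icross a' b := by
        rw [hx]; simp [icross]; ring
      rw [e2] at h1 h3
      rw [hdk] at h3
      simp only [Finset.coe_image, Set.mem_image, Finset.mem_coe, Finset.mem_Ioo]
      exact ⟨j, ⟨pos_of_mul_pos_left h1 hk0.le, lt_of_mul_lt_mul_right h3 hk0.le⟩, hx.symm⟩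
    have h1 := Set.ncard_le_ncard hsub (Finset.finite_toSet _)
    rw [Set.ncard_coe_finset] at h1
    have h2 := h1.trans Finset.card_image_le
    rw [Int.card_Ioo] at h2
    omega
  have hIle : I.ncard + content b ≤ (halfOpenTriangle a b).ncard := by
    obtain ⟨b', c, hbc, hc⟩ := exists_primitive hb
    have hgpos := content_pos hb
    set g := content b
    have hg0 : (0 : ℤ) < g := by exact_mod_cast hgpos
    have hdk : d = g * icross a b' := by
      rw [hd, hbc]; simp [icross]; ring
    have hk0 : 0 < icross a b' := by
      rw [hdk] at h
      exact pos_of_mul_pos_right h hg0.le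
    have hb' : b' ≠ 0 := by
      rintro rfl
      simp [icross] at hc
    set J : Finset (ℤ × ℤ) := (Finset.Icc 1 (g : ℤ)).image fun j => j • b' with hJ
    have hJcard : J.card = g := by
      rw [hJ, Finset.card_image_of_injective _ (smul_left_injective ℤ hb'), Int.card_Icc]
      omega
    have e0 : ∀ j : ℤ, icross (j • b') b = 0 := by
      intro j
      rw [hbc]; simp [icross]; ring
    have e1 : ∀ j : ℤ, icross a (j • b') = j * icross a b' := by
      intro j
      simp [icross]; ring
    have hdisj : Disjoint I (J : Set (ℤ × ℤ)) := by
      rw [Set.disjoint_left]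
      rintro x ⟨h1, -, -⟩ hx
      simp only [hJ, Finset.coe_image, Set.mem_image, Finset.mem_coe] at hx
      obtain ⟨j, -, rfl⟩ := hx
      simp only [e0] at h1
      exact h1.false
    rw [← hJcard, ← Set.ncard_coe_finset, ← Set.ncard_union_eq hdisj hIfin (Finset.finite_toSet _)]
    apply Set.ncard_le_ncard _ hTfin
    rintro x (hx | hx)
    · exact ⟨hx.1.le, hx.2.1, hx.2.2.le⟩
    · simp only [hJ, Finset.coe_image, Set.mem_image, Finset.mem_coe, Finset.mem_Icc] at hx
      obtain ⟨j, ⟨hj1, hj2⟩, rfl⟩ := hx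
      refine ⟨?_, ?_, ?_⟩
      · simp only [e0, le_refl]
      · simp only [e1]
        exact mul_pos (by linarith) hk0
      · simp only [e0, e1, zero_add, ← hd, hdk]
        exact mul_le_mul_of_nonneg_right hj2 hk0.le
  zify at hPle hEle hIle
  linarith

lemma combo_mem_of_convex {E : Type*} [AddCommGroup E] [Module ℝ E] {K : Set E} (hK : Convex ℝ K)
    {x y z : E} (hx : x ∈ K) (hy : y ∈ K) (hz : z ∈ K) {α β γ : ℝ} (hα : 0 ≤ α) (hβ : 0 ≤ β)
    (hγ : 0 ≤ γ) (h : α + β + γ = 1) : α • x + β • y + γ • z ∈ K := by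
  have := hK.sum_mem (t := Finset.univ) (w := ![α, β, γ]) (z := ![x, y, z])
    (by intro i _; fin_cases i <;> simpa) (by simpa [Fin.sum_univ_three] using h)
    (by intro i _; fin_cases i <;> simpa)
  simpa [Fin.sum_univ_three] using this

lemma toPlane_mem_of_cramer {K : Set (ℝ × ℝ)} (hK : Convex ℝ K) {a b x : ℤ × ℤ}
    (h0 : (0 : ℝ × ℝ) ∈ K)
    (ha : toPlane a ∈ K) (hb : toPlane b ∈ K) (hab : 0 < icross a b) (h1 : 0 ≤ icross x b)
    (h2 : 0 ≤ icross a x) (h3 : icross x b + icross a x ≤ icross a b) : toPlane x ∈ K := by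
  have hd : (0 : ℝ) < icross a b := by exact_mod_cast hab
  have h1' : (0 : ℝ) ≤ icross x b := by exact_mod_cast h1
  have h2' : (0 : ℝ) ≤ icross a x := by exact_mod_cast h2
  have h3' : (icross x b : ℝ) + icross a x ≤ icross a b := by exact_mod_cast h3
  have := combo_mem_of_convex hK ha hb h0 (α := icross x b / icross a b)
    (β := icross a x / icross a b) (γ := 1 - icross x b / icross a b - icross a x / icross a b)
    (by positivity) (by positivity) (by
      rw [sub_sub, ← add_div, sub_nonneg, div_le_one hd]; exact h3') (by ring)
  convert this using 1
  have e := icross_smul_eq a b x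
  have e1 := congrArg (fun p => (p.1 : ℝ)) e
  have e2 := congrArg (fun p => (p.2 : ℝ)) e
  simp only [Prod.smul_fst, Prod.smul_snd, Prod.fst_add, Prod.snd_add, smul_eq_mul] at e1 e2
  push_cast at e1 e2
  ext
  · simp only [toPlane, Prod.fst_add, Prod.smul_fst, smul_eq_mul, smul_zero, add_zero]
    field_simp
    linarith
  · simp only [toPlane, Prod.snd_add, Prod.smul_snd, smul_eq_mul, smul_zero, add_zero]
    field_simp
    linarith

/-- The lattice points of a convex polygon with vertex `0`, counted by the triangles of the fan
from `0`. The next side of the fan is included in the bound in order to glue the triangles. -/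
lemma exists_lattice_points_fan (w : ℕ → ℤ × ℤ) (m : ℕ)
    (hw : ∀ i j, 1 ≤ i → i < j → j ≤ m + 1 → 0 < icross (w i) (w j)) (hw0 : w 0 = 0)
    (hw1 : w 1 ≠ 0) :
    ∃ K : Finset (ℤ × ℤ),
      (∀ x ∈ K, toPlane x ∈ convexHull ℝ ((fun i => toPlane (w i)) '' Set.Iic (m + 1))) ∧
      ∑ i ∈ Finset.range m, icross (w (i + 1)) (w (i + 2)) + (m + 1) + content (w (m + 1)) + 2 ≤
        2 * (K.card : ℤ) := by
  induction m with
  | zero =>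
    obtain ⟨a', c, hac, hc⟩ := exists_primitive hw1
    have hgpos := content_pos hw1
    set g := content (w 1)
    have ha' : a' ≠ 0 := by
      rintro rfl
      simp [icross] at hc
    have hg0 : (0 : ℝ) < g := by exact_mod_cast hgpos
    refine ⟨(Finset.Icc 0 (g : ℤ)).image fun j => j • a', ?_, ?_⟩
    · intro x hx
      obtain ⟨j, hj, rfl⟩ := Finset.mem_image.1 hx
      rw [Finset.mem_Icc] at hj
      have hj0 : (0 : ℝ) ≤ j := by exact_mod_cast hj.1
      have hjg : (j : ℝ) ≤ g := by exact_mod_cast hj.2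
      have h0 : (0 : ℝ × ℝ) ∈ convexHull ℝ ((fun i => toPlane (w i)) '' Set.Iic (0 + 1)) :=
        subset_convexHull ℝ _ ⟨0, by simp, by simp [hw0, toPlane]⟩
      have h1 : toPlane (w 1) ∈ convexHull ℝ ((fun i => toPlane (w i)) '' Set.Iic (0 + 1)) :=
        subset_convexHull ℝ _ ⟨1, by simp, rfl⟩
      have := (convex_convexHull ℝ _) h0 h1 (a := 1 - j / g) (b := j / g)
        (by rw [sub_nonneg, div_le_one hg0]; exact hjg) (by positivity) (by ring)
      convert this using 1
      rw [hac]
      ext <;> simp [toPlane] <;> field_simp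
    · rw [Finset.card_image_of_injective _ (smul_left_injective ℤ ha'), Int.card_Icc]
      simp only [Finset.range_zero, Finset.sum_empty, zero_add]
      push_cast
      omega
  | succ m ih =>
    obtain ⟨K, hK, hcard⟩ := ih fun i j h1 h2 h3 => hw i j h1 h2 (by omega)
    have hpos := hw (m + 1) (m + 2) (by omega) (by omega) (by omega)
    have hfin := finite_halfOpenTriangle hpos
    have hpick := le_two_mul_ncard_halfOpenTriangle hpos
    rw [Set.ncard_eq_toFinset_card _ hfin] at hpick
    have hdisj : Disjoint K hfin.toFinset := by
      rw [Finset.disjoint_left]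
      intro x hx hx'
      rw [Set.Finite.mem_toFinset] at hx'
      -- the triangle lies strictly on the left of `w (m + 1)`, the points of `K` do not
      have hconv : Convex ℝ {z : ℝ × ℝ | cross (toPlane (w (m + 1))) z ≤ 0} := by
        intro y hy z hz a b ha hb _
        simp only [Set.mem_ofPred_eq] at *
        rw [cross_add_right, cross_smul_right, cross_smul_right]
        nlinarith [mul_nonneg ha (neg_nonneg.2 hy), mul_nonneg hb (neg_nonneg.2 hz)]
      have hmem := convexHull_min (s := (fun i => toPlane (w i)) '' Set.Iic (m + 1)) (by
        rintro _ ⟨i, hi, rfl⟩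
        simp only [Set.mem_ofPred_eq, cross_toPlane]
        rw [Set.mem_Iic] at hi
        have : icross (w (m + 1)) (w i) ≤ 0 := by
          rcases Nat.eq_zero_or_pos i with rfl | hi0
          · rw [hw0]; simp [icross]
          rcases hi.eq_or_lt with rfl | hlt
          · simp only [icross]; linarith
          · have := hw i (m + 1) hi0 hlt (by omega)
            simp only [icross] at *
            linarith
        exact_mod_cast this) hconv (hK x hx)
      simp only [Set.mem_ofPred_eq, cross_toPlane] at hmem
      have h2 : (0 : ℝ) < icross (w (m + 1)) x := by exact_mod_cast hx'.2.1
      linarith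
    refine ⟨K ∪ hfin.toFinset, ?_, ?_⟩
    · intro x hx
      rcases Finset.mem_union.1 hx with hx | hx
      · refine convexHull_mono (Set.image_mono ?_) (hK x hx)
        exact Set.Iic_subset_Iic.2 (by omega)
      · rw [Set.Finite.mem_toFinset] at hx
        exact toPlane_mem_of_cramer (convex_convexHull ℝ _)
          (subset_convexHull ℝ _ ⟨0, by simp, by simp [hw0, toPlane]⟩)
          (subset_convexHull ℝ _ ⟨m + 1, by simp, rfl⟩)
          (subset_convexHull ℝ _ ⟨m + 2, by simp, rfl⟩) hpos hx.1 hx.2.1.le hx.2.2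
    · rw [Finset.card_union_of_disjoint hdisj, Finset.sum_range_succ]
      push_cast
      change _ + (content (w (m + 2)) : ℤ) + 2 ≤ _
      linarith

/-! ### Sets of lattice points in convex position -/

lemma exists_enum_of_injOn {α : Type*} [Inhabited α] (S : Finset α) (f : α → ℚ)
    (hf : Set.InjOn f S) :
    ∃ e : ℕ → α, (∀ i < S.card, e i ∈ S) ∧ ∀ i j, i < j → j < S.card → f (e i) < f (e j) := by
  have hcard : (S.image f).card = S.card := Finset.card_image_of_injOn hf
  set o := (S.image f).orderEmbOfFin hcard
  have ho : ∀ i, ∃ x ∈ S, f x = o i := fun i =>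
    Finset.mem_image.1 (Finset.orderEmbOfFin_mem (S.image f) hcard i)
  choose e he hfe using ho
  refine ⟨fun i => if h : i < S.card then e ⟨i, h⟩ else default, fun i hi => ?_,
    fun i j hij hj => ?_⟩
  · simp only [hi, dif_pos]
    exact he _
  · simp only [hj, hij.trans hj, dif_pos, hfe]
    exact o.strictMono hij

/-- The abscissa of a convex polygon has no local minimum away from the leftmost vertex. -/
lemma fst_lt_or_fst_lt_of_middle {P Q R : ℤ × ℤ} (hP : 0 < P.1) (hR : 0 < R.1)
    (h1 : 0 < icross P Q) (h2 : 0 < icross Q R) (h3 : 0 < icross P R)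
    (h4 : icross P R < icross P Q + icross Q R) : P.1 < Q.1 ∨ R.1 < Q.1 := by
  by_contra hcon
  push Not at hcon
  have e : Q.1 * icross P R = P.1 * icross Q R + R.1 * icross P Q := by
    simp only [icross]; ring
  have hQ : 0 < Q.1 * icross P R := by
    rw [e]; positivity
  have hQ0 : 0 < Q.1 := pos_of_mul_pos_left hQ h3.le
  nlinarith [mul_le_mul_of_nonneg_right hcon.1 h2.le, mul_le_mul_of_nonneg_right hcon.2 h1.le,
    mul_lt_mul_of_pos_left h4 hQ0]

/-- In a convex polygon with a vertex at `0` and all other vertices in the right half-plane, ordered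
counterclockwise, any three vertices are positively oriented. -/
lemma icross_lt_of_convex_position {U : Finset (ℤ × ℤ)} (h0 : (0 : ℤ × ℤ) ∈ U)
    (hU : ∀ u ∈ U, toPlane u ∉ convexHull ℝ (toPlane '' (U \ {u} : Set (ℤ × ℤ)))) {P Q R : ℤ × ℤ}
    (hP : P ∈ U) (hQ : Q ∈ U) (hR : R ∈ U) (h1 : 0 < icross P Q) (h2 : 0 < icross Q R)
    (h3 : 0 < icross P R) : icross P R < icross P Q + icross Q R := by
  by_contra hcon
  push Not at hcon
  apply hU Q hQ
  have hne : ∀ X ∈ U, X ≠ Q → toPlane X ∈ convexHull ℝ (toPlane '' (U \ {Q} : Set (ℤ × ℤ))) :=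
    fun X hX hXQ => subset_convexHull ℝ _ ⟨X, ⟨hX, hXQ⟩, rfl⟩
  refine toPlane_mem_of_cramer (convex_convexHull ℝ _) ?_ (hne P hP ?_) (hne R hR ?_) h3 h2.le
    h1.le (by linarith)
  · have := hne 0 h0 (by rintro rfl; simp [icross] at h1)
    rwa [show toPlane 0 = 0 by simp [toPlane]] at this
  · rintro rfl
    simp [icross, mul_comm] at h1
  · rintro rfl
    simp [icross, mul_comm] at h2

/-- The number of vertices of a convex lattice polygon, with a vertex at `0` and with the vertices
in general position relative to the vertical direction, is bounded in terms of the number of its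
lattice points, by way of its area. -/
theorem exists_lattice_points_pow_three_le {U : Finset (ℤ × ℤ)} (h0 : (0 : ℤ × ℤ) ∈ U)
    (hpos : ∀ u ∈ U, u ≠ 0 → 0 < u.1) (hinj : Set.InjOn Prod.fst (U : Set (ℤ × ℤ)))
    (hU : ∀ u ∈ U, toPlane u ∉ convexHull ℝ (toPlane '' (U \ {u} : Set (ℤ × ℤ))))
    (hcard : 3 ≤ U.card) :
    ∃ K : Finset (ℤ × ℤ), (∀ x ∈ K, toPlane x ∈ convexHull ℝ (toPlane '' (U : Set (ℤ × ℤ)))) ∧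
      (U.card : ℝ) ^ 3 ≤ 4 * Real.pi ^ 2 * (2 * K.card - U.card - 2) := by
  obtain ⟨n, hn⟩ : ∃ n, n = U.card := ⟨_, rfl⟩
  set S := U.erase 0 with hS
  have hScard : S.card = n - 1 := by rw [hS, Finset.card_erase_of_mem h0, hn]
  have hSU : ∀ u ∈ S, u ∈ U ∧ 0 < u.1 := fun u hu =>
    ⟨Finset.mem_of_mem_erase hu, hpos u (Finset.mem_of_mem_erase hu) (Finset.ne_of_mem_erase hu)⟩
  -- No two vertices are collinear with `0`, so the slopes are distinct.
  have hslope : Set.InjOn (fun u : ℤ × ℤ => (u.2 : ℚ) / u.1) S := by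
    intro x hx y hy hxy
    wlog hle : x.1 ≤ y.1 generalizing x y
    · exact (this hy hx hxy.symm (le_of_not_ge hle)).symm
    by_contra hne
    obtain ⟨hxU, hx1⟩ := hSU x hx
    obtain ⟨hyU, hy1⟩ := hSU y hy
    have e : x.2 * y.1 = y.2 * x.1 := by
      have hx1' : (x.1 : ℚ) ≠ 0 := by exact_mod_cast hx1.ne'
      have hy1' : (y.1 : ℚ) ≠ 0 := by exact_mod_cast hy1.ne'
      have := (div_eq_div_iff hx1' hy1').1 hxy
      exact_mod_cast this
    apply hU x hxU
    have hx1r : (0 : ℝ) < x.1 := by exact_mod_cast hx1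
    have hy1r : (0 : ℝ) < y.1 := by exact_mod_cast hy1
    have hler : (x.1 : ℝ) ≤ y.1 := by exact_mod_cast hle
    have er : (x.2 : ℝ) * y.1 = y.2 * x.1 := by exact_mod_cast e
    have m0 : (0 : ℝ × ℝ) ∈ convexHull ℝ (toPlane '' (U \ {x} : Set (ℤ × ℤ))) :=
      subset_convexHull ℝ _ ⟨0, ⟨h0, by rintro rfl; simp at hx1⟩, by simp [toPlane]⟩
    have m1 : toPlane y ∈ convexHull ℝ (toPlane '' (U \ {x} : Set (ℤ × ℤ))) :=
      subset_convexHull ℝ _ ⟨y, ⟨hyU, fun h => hne h.symm⟩, rfl⟩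
    have := (convex_convexHull ℝ _) m0 m1 (a := 1 - x.1 / y.1) (b := x.1 / y.1)
      (by rw [sub_nonneg, div_le_one hy1r]; exact hler) (by positivity) (by ring)
    convert this using 1
    ext
    · simp [toPlane]; field_simp
    · simp [toPlane]; field_simp; linarith
  obtain ⟨e, heS, hemono⟩ := exists_enum_of_injOn S _ hslope
  rw [hScard] at heS hemono
  set u : ℕ → ℤ × ℤ := fun i => if i = 0 then 0 else e (i - 1) with hu
  have hu0 : u 0 = 0 := rfl
  have hum : ∀ i, 1 ≤ i → i < n → u i ∈ U ∧ 0 < (u i).1 := by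
    intro i h1 h2
    have : u i = e (i - 1) := by simp only [hu]; rw [if_neg (by omega)]
    rw [this]
    exact hSU _ (heS _ (by omega))
  have hC : ∀ i j, 1 ≤ i → i < j → j < n → 0 < icross (u i) (u j) := by
    intro i j h1 h2 h3
    obtain ⟨-, hi⟩ := hum i h1 (by omega)
    obtain ⟨-, hj⟩ := hum j (by omega) h3
    have := hemono (i - 1) (j - 1) (by omega) (by omega)
    have e1 : u i = e (i - 1) := by simp only [hu]; rw [if_neg (by omega)]
    have e2 : u j = e (j - 1) := by simp only [hu]; rw [if_neg (by omega)]
    rw [← e1, ← e2, div_lt_div_iff₀ (by exact_mod_cast hi) (by exact_mod_cast hj)] at this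
    have h' : (u i).2 * (u j).1 < (u j).2 * (u i).1 := by exact_mod_cast this
    simp only [icross]
    linarith
  have hC3 : ∀ i j k, 1 ≤ i → i < j → j < k → k < n →
      icross (u i) (u k) < icross (u i) (u j) + icross (u j) (u k) := fun i j k h1 h2 h3 h4 =>
    icross_lt_of_convex_position h0 hU (hum i h1 (by omega)).1 (hum j (by omega) (by omega)).1
      (hum k (by omega) h4).1 (hC i j h1 h2 (by omega)) (hC j k (by omega) h3 h4)
      (hC i k h1 (by omega) h4)
  have hinj' : ∀ i j, 1 ≤ i → i < j → j < n → (u i).1 ≠ (u j).1 := by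
    intro i j h1 h2 h3 h4
    have h5 := hC i j h1 h2 h3
    rw [hinj (hum i h1 (by omega)).1 (hum j (by omega) h3).1 h4] at h5
    simp [icross, mul_comm] at h5
  -- The abscissa increases up to the rightmost vertex and decreases afterwards.
  obtain ⟨r, hr, hmax⟩ := Finset.exists_max_image (Finset.Ico 1 n) (fun i => (u i).1)
    ⟨1, by rw [Finset.mem_Ico]; omega⟩
  rw [Finset.mem_Ico] at hr
  have hmax' : ∀ i, 1 ≤ i → i < n → (u i).1 ≤ (u r).1 := fun i h1 h2 =>
    hmax i (by rw [Finset.mem_Ico]; omega)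
  set v : ℕ → ℝ × ℝ := fun i => toPlane (u (i % n)) with hv
  have hvlt : ∀ i < n, v i = toPlane (u i) := fun i hi => by
    simp only [hv, Nat.mod_eq_of_lt hi]
  have hvn : v n = toPlane (u 0) := by simp [hv]
  have hvn1 : v (n + 1) = toPlane (u 1) := by
    simp only [hv, Nat.add_mod_left, Nat.mod_eq_of_lt (show 1 < n by omega)]
  have hz : toPlane 0 = 0 := by simp [toPlane]
  have hcast : ∀ a b : ℤ × ℤ, 0 < icross a b → 1 ≤ cross (toPlane a) (toPlane b) := by
    intro a b h
    rw [cross_toPlane]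
    exact_mod_cast h
  have hiso := card_pow_three_le_area (v := v) (n := n) (r := r) (by omega) (by omega)
    (by rw [hvn, hvlt 0 (by omega)]) (by rw [hvn1, hvlt 1 (by omega)]) ?_ ?_ ?_
  rotate_left
  · intro i hi
    rcases Nat.eq_zero_or_pos i with rfl | hi0
    · rw [hvlt 0 (by omega), hvlt 1 (by omega), hvlt 2 (by omega), hu0, hz]
      have := hcast _ _ (hC 1 2 le_rfl (by omega) (by omega))
      refine this.trans_eq ?_
      simp only [cross, sub_zero, Prod.fst_sub, Prod.snd_sub]; ring
    rcases lt_trichotomy (i + 2) n with h | h | h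
    · rw [hvlt i hi, hvlt (i + 1) (by omega), hvlt (i + 2) h]
      have h1 : (1 : ℝ) ≤ ((icross (u i) (u (i + 1)) + icross (u (i + 1)) (u (i + 2)) -
          icross (u i) (u (i + 2)) : ℤ) : ℝ) := by
        have := hC3 i (i + 1) (i + 2) hi0 (by omega) (by omega) h
        have : 1 ≤ icross (u i) (u (i + 1)) + icross (u (i + 1)) (u (i + 2)) -
          icross (u i) (u (i + 2)) := by linarith
        exact_mod_cast this
      refine h1.trans_eq ?_
      push_cast
      simp only [← cross_toPlane]
      simp only [cross, Prod.fst_sub, Prod.snd_sub]; ring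
    · rw [hvlt i hi, hvlt (i + 1) (by omega), h, hvn, hu0, hz]
      refine (hcast _ _ (hC i (i + 1) hi0 (by omega) (by omega))).trans_eq ?_
      simp only [cross, Prod.fst_sub, Prod.snd_sub, Prod.fst_zero, Prod.snd_zero]; ring
    · have hin : i + 1 = n := by omega
      rw [show i + 2 = n + 1 by omega, hvlt i hi, hin, hvn, hvn1, hu0, hz]
      refine (hcast _ _ (hC 1 i le_rfl (by omega) hi)).trans_eq ?_
      simp only [cross, Prod.fst_sub, Prod.snd_sub, Prod.fst_zero, Prod.snd_zero]; ring
  · intro i hi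
    rw [hvlt i (by omega), hvlt (i + 1) (by omega)]
    have : (u i).1 < (u (i + 1)).1 := by
      rcases Nat.eq_zero_or_pos i with rfl | hi0
      · rw [hu0]; exact (hum 1 le_rfl (by omega)).2
      rcases (show i + 1 ≤ r from hi).eq_or_lt with h | h
      · have h1 := hmax' i hi0 (by omega)
        have h2 := hinj' i r hi0 hi hr.2
        rw [h]; omega
      · rcases fst_lt_or_fst_lt_of_middle (hum i hi0 (by omega)).2 (hum r hr.1 hr.2).2
          (hC i (i + 1) hi0 (by omega) (by omega)) (hC (i + 1) r (by omega) h hr.2)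
          (hC i r hi0 hi hr.2) (hC3 i (i + 1) r hi0 (by omega) h hr.2) with h' | h'
        · exact h'
        · exact absurd h' (not_lt.2 (hmax' _ (by omega) (by omega)))
    simp only [toPlane]
    exact_mod_cast this
  · intro i hi hin
    have : (u ((i + 1) % n)).1 < (u i).1 := by
      rcases (show i + 1 ≤ n from hin).eq_or_lt with h | h
      · rw [h, Nat.mod_self, hu0]
        exact (hum i (by omega) hin).2
      rw [Nat.mod_eq_of_lt h]
      rcases hi.eq_or_lt with rfl | hlt
      · have h1 := hmax' (r + 1) (by omega) h
        have h2 := hinj' r (r + 1) hr.1 (by omega) h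
        omega
      · rcases fst_lt_or_fst_lt_of_middle (hum r hr.1 hr.2).2 (hum (i + 1) (by omega) h).2
          (hC r i hr.1 hlt hin) (hC i (i + 1) (by omega) (by omega) h)
          (hC r (i + 1) hr.1 (by omega) h) (hC3 r i (i + 1) hr.1 hlt (by omega) h) with h' | h'
        · exact absurd h' (not_lt.2 (hmax' _ (by omega) hin))
        · exact h'
    rw [hvlt i hin]
    simp only [hv, toPlane]
    exact_mod_cast this
  obtain ⟨m, rfl⟩ : ∃ m, n = m + 2 := ⟨n - 2, by omega⟩
  have hlast : u (m + 1) ≠ 0 := by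
    intro h
    have := (hum (m + 1) (by omega) (by omega)).2
    rw [h] at this
    simp at this
  obtain ⟨K, hK, hKcard⟩ := exists_lattice_points_fan u m
    (fun i j h1 h2 h3 => hC i j h1 h2 (by omega)) hu0 (by
      intro h
      have := (hum 1 (by omega) (by omega)).2
      rw [h] at this
      simp at this)
  refine ⟨K, fun x hx => convexHull_mono ?_ (hK x hx), ?_⟩
  · rintro _ ⟨i, hi, rfl⟩
    rw [Set.mem_Iic] at hi
    refine ⟨u i, ?_, rfl⟩
    rcases Nat.eq_zero_or_pos i with rfl | hi0
    · exact h0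
    · exact (hum i hi0 (by omega)).1
  · rw [← hn]
    refine hiso.trans ?_
    have hsum : ∑ i ∈ Finset.range (m + 2), cross (v i) (v (i + 1)) =
        ((∑ i ∈ Finset.range m, icross (u (i + 1)) (u (i + 2)) : ℤ) : ℝ) := by
      rw [Finset.sum_range_succ, Finset.sum_range_succ', hvlt 0 (by omega), hvn, hu0, hz,
        cross_zero_right]
      push_cast
      rw [show cross 0 (v (0 + 1)) = 0 by simp [cross], add_zero, add_zero]
      refine Finset.sum_congr rfl fun i hi => ?_
      rw [Finset.mem_range] at hi
      rw [hvlt (i + 1) (by omega), hvlt (i + 1 + 1) (by omega), cross_toPlane]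
    rw [hsum]
    have hc := content_pos hlast
    have hKcard' : ∑ i ∈ Finset.range m, icross (u (i + 1)) (u (i + 2)) ≤
        2 * (K.card : ℤ) - (m + 2 : ℕ) - 2 := by
      push_cast
      have : (1 : ℤ) ≤ content (u (m + 1)) := by exact_mod_cast hc
      linarith
    have hR : ((∑ i ∈ Finset.range m, icross (u (i + 1)) (u (i + 2)) : ℤ) : ℝ) ≤
        2 * K.card - (m + 2 : ℕ) - 2 := by exact_mod_cast hKcard'
    gcongr

lemma InConvexPosition.notMem_convexHull {n : ℕ} {V : Finset (Fin n → ℤ)} (hV : InConvexPosition V)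
    {x : Fin n → ℤ} (hx : x ∈ V) :
    toReal x ∉ convexHull ℝ (toReal '' (V \ {x} : Set (Fin n → ℤ))) := by
  intro hmem
  have := hV {v : V | (v : Fin n → ℤ) ≠ x} ⟨x, hx⟩ (by
    refine convexHull_mono ?_ hmem
    rintro _ ⟨y, ⟨hy, hyx⟩, rfl⟩
    exact ⟨⟨y, hy⟩, hyx, rfl⟩)
  exact this rfl

lemma toReal_injective {n : ℕ} : Function.Injective (toReal (n := n)) := by
  intro x y h
  funext i
  have := congrFun h i
  simpa [toReal] using this

lemma finite_iconv {n : ℕ} (V : Finset (Fin n → ℤ)) : (iconv V).Finite := by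
  set M : Fin n → ℤ := fun i => ∑ v ∈ V, |v i| with hM
  refine (Set.finite_Icc (-M) M).subset fun x hx => ?_
  have hsub : toReal '' (V : Set (Fin n → ℤ)) ⊆ Set.Icc (toReal (-M)) (toReal M) := by
    rintro _ ⟨v, hv, rfl⟩
    have h : ∀ i, |v i| ≤ M i := fun i =>
      Finset.single_le_sum (f := fun v : Fin n → ℤ => |v i|) (fun _ _ => abs_nonneg _) hv
    constructor <;> intro i <;> simp only [toReal, Pi.neg_apply] <;> norm_cast
    · exact (abs_le.1 (h i)).1
    · exact (abs_le.1 (h i)).2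
  have := convexHull_min hsub (convex_Icc _ _) hx
  constructor <;> intro i
  · have := this.1 i
    simp only [toReal] at this
    exact_mod_cast this
  · have := this.2 i
    simp only [toReal] at this
    exact_mod_cast this

/-- A unimodular change of coordinates puts the lattice points in general position relative to the
vertical direction and moves the leftmost one to the origin. -/
theorem InConvexPosition.card_pow_three_le {V : Finset (Fin 2 → ℤ)} (hV : InConvexPosition V)
    (hcard : 3 ≤ V.card) :
    (V.card : ℝ) ^ 3 ≤ 4 * Real.pi ^ 2 * (2 * (iconv V).ncard - V.card - 2) := by
  set M : ℤ := 2 * ∑ v ∈ V, |v 1| + 1 with hM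
  have hMV : ∀ x ∈ V, ∀ y ∈ V, |x 1 - y 1| < M := by
    intro x hx y hy
    have h : ∀ v ∈ V, |v 1| ≤ ∑ v ∈ V, |v 1| := fun v hv =>
      Finset.single_le_sum (f := fun v : Fin 2 → ℤ => |v 1|) (fun _ _ => abs_nonneg _) hv
    have h1 := h x hx
    have h2 := h y hy
    have h3 := abs_sub (x 1) (y 1)
    omega
  have hξ : ∀ x ∈ V, ∀ y ∈ V, M * x 0 + x 1 = M * y 0 + y 1 → x = y := by
    intro x hx y hy h
    have hlt := hMV x hx y hy
    have e : M * (y 0 - x 0) = x 1 - y 1 := by linarith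
    have hMpos : 0 < M := (abs_nonneg _).trans_lt hlt
    rw [← e, abs_mul, abs_of_pos hMpos] at hlt
    have h0 : |y 0 - x 0| < 1 := by
      by_contra hcon
      nlinarith
    have h1 : y 0 - x 0 = 0 := Int.abs_lt_one_iff.1 h0
    have h2 : x 1 - y 1 = 0 := by rw [← e, h1, mul_zero]
    funext i
    fin_cases i
    · simp only [Fin.zero_eta]; linarith
    · simp only [Fin.mk_one]; linarith
  obtain ⟨o, ho, hmin⟩ := Finset.exists_min_image V (fun x => M * x 0 + x 1)
    (Finset.card_pos.1 (by omega))
  let ψ : (Fin 2 → ℤ) → ℤ × ℤ := fun x => (M * (x 0 - o 0) + (x 1 - o 1), -(x 0 - o 0))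
  let χ : ℤ × ℤ → (Fin 2 → ℤ) := fun p => ![o 0 - p.2, o 1 + p.1 + M * p.2]
  let A : ℝ × ℝ → (Fin 2 → ℝ) := fun p => ![o 0 - p.2, o 1 + p.1 + M * p.2]
  have hχψ : ∀ x, χ (ψ x) = x := by
    intro x
    funext i
    fin_cases i
    · simp [χ, ψ]
    · simp [χ, ψ]; ring
  have hψinj : Function.Injective ψ := Function.LeftInverse.injective hχψ
  have hχinj : Function.Injective χ := by
    intro p q h
    have h0 := congrFun h 0
    have h1 := congrFun h 1
    simp only [χ, Matrix.cons_val_zero, Matrix.cons_val_one] at h0 h1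
    have e2 : p.2 = q.2 := by linarith
    rw [e2] at h1
    exact Prod.ext (by linarith) e2
  have hA : ∀ p, A (toPlane p) = toReal (χ p) := by
    intro p
    funext i
    fin_cases i <;> simp [A, χ, toPlane, toReal]
  have hAconv : ∀ (C : Set (Fin 2 → ℝ)), Convex ℝ C → Convex ℝ (A ⁻¹' C) := by
    intro C hC x hx y hy a b ha hb hab
    have : A (a • x + b • y) = a • A x + b • A y := by
      obtain rfl : b = 1 - a := by linarith
      funext i
      fin_cases i
      · simp [A]; ring
      · simp [A]; ring
    rw [Set.mem_preimage, this]
    exact hC hx hy ha hb hab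
  have hhull : ∀ (W : Set (Fin 2 → ℤ)) (p : ℤ × ℤ),
      toPlane p ∈ convexHull ℝ (toPlane '' (ψ '' W)) →
        toReal (χ p) ∈ convexHull ℝ (toReal '' W) := by
    intro W p hp
    rw [← hA]
    refine convexHull_min ?_ (hAconv _ (convex_convexHull ℝ _)) hp
    rintro _ ⟨_, ⟨x, hx, rfl⟩, rfl⟩
    rw [Set.mem_preimage, hA, hχψ]
    exact subset_convexHull ℝ _ ⟨x, hx, rfl⟩
  set U := V.image ψ with hU
  have hUcard : U.card = V.card := Finset.card_image_of_injective _ hψinj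
  have hU0 : (0 : ℤ × ℤ) ∈ U := Finset.mem_image.2 ⟨o, ho, by simp [ψ]⟩
  have hUpos : ∀ u ∈ U, u ≠ 0 → 0 < u.1 := by
    intro u hu hu0
    obtain ⟨x, hx, rfl⟩ := Finset.mem_image.1 hu
    have h1 := hmin x hx
    have h2 : M * o 0 + o 1 ≠ M * x 0 + x 1 := fun h => hu0 (by
      rw [← hξ o ho x hx h]; simp [ψ])
    have h3 : M * o 0 + o 1 < M * x 0 + x 1 := lt_of_le_of_ne h1 h2
    simp only [ψ]
    linarith
  have hUinj : Set.InjOn Prod.fst (U : Set (ℤ × ℤ)) := by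
    intro p hp q hq hpq
    obtain ⟨x, hx, rfl⟩ := Finset.mem_image.1 (Finset.mem_coe.1 hp)
    obtain ⟨y, hy, rfl⟩ := Finset.mem_image.1 (Finset.mem_coe.1 hq)
    simp only [ψ] at hpq
    rw [hξ x hx y hy (by linarith)]
  have hUcp : ∀ u ∈ U, toPlane u ∉ convexHull ℝ (toPlane '' (U \ {u} : Set (ℤ × ℤ))) := by
    intro u hu hmem
    obtain ⟨x, hx, rfl⟩ := Finset.mem_image.1 hu
    have e : ((U : Set (ℤ × ℤ)) \ {ψ x}) = ψ '' (V \ {x} : Set (Fin 2 → ℤ)) := by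
      rw [Set.image_sdiff hψinj, hU, Finset.coe_image, Set.image_singleton]
    rw [e] at hmem
    have := hhull _ _ hmem
    rw [hχψ] at this
    exact hV.notMem_convexHull hx this
  obtain ⟨K, hK, hKcard⟩ :=
    exists_lattice_points_pow_three_le hU0 hUpos hUinj hUcp (by rw [hUcard]; exact hcard)
  rw [hUcard] at hKcard
  refine hKcard.trans ?_
  have hle : K.card ≤ (iconv V).ncard := by
    rw [← Finset.card_image_of_injective K hχinj, ← Set.ncard_coe_finset]
    refine Set.ncard_le_ncard ?_ (finite_iconv V)
    intro x hx
    obtain ⟨p, hp, rfl⟩ := Finset.mem_image.1 (Finset.mem_coe.1 hx)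
    have := hK p hp
    rw [hU, Finset.coe_image] at this
    exact hhull _ _ this
  have : (K.card : ℝ) ≤ (iconv V).ncard := by exact_mod_cast hle
  gcongr

/-! ### From convex position to systems of inequalities -/

/-- One after the other, the right-hand sides of an irredundant system are increased as long as
no point of the finite set `Y` becomes a solution; then each inequality, taken strictly, is violated
by a point `y i` that lies on its boundary and satisfies the other inequalities strictly. -/
lemma exists_relaxation {X ι : Type*} [Inhabited X] [DecidableEq ι] (Y : Finset X) (L : ι → X → ℝ)
    (b : ι → ℝ) (I : Finset ι)
    (hx : ∀ i ∈ I, ∃ x ∈ Y, b i < L i x ∧ ∀ j ∈ I, j ≠ i → L j x ≤ b j)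
    (J : Finset ι) (hJ : J ⊆ I) :
    ∃ y : ι → X, (∀ i ∈ J, y i ∈ Y ∧ b i < L i (y i)) ∧
      (∀ i ∈ J, ∀ j ∈ J, j ≠ i → L j (y i) < L j (y j)) ∧
      (∀ i ∈ J, ∀ j ∈ I, j ∉ J → L j (y i) ≤ b j) ∧
      ∀ x ∈ Y, (∀ j ∈ J, L j x < L j (y j)) → (∀ j ∈ I, j ∉ J → L j x ≤ b j) →
        ∀ j ∈ I, L j x ≤ b j := by
  classical
  induction J using Finset.induction_on with
  | empty =>
    exact ⟨fun _ => default, by simp, by simp, by simp, fun x _ _ h j hj => h j hj (by simp)⟩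
  | insert i J hi ih =>
    obtain ⟨y, h1, h2, h3, h4⟩ := ih ((Finset.subset_insert _ _).trans hJ)
    have hiI : i ∈ I := hJ (Finset.mem_insert_self _ _)
    set C := Y.filter fun x => b i < L i x ∧ (∀ j ∈ J, L j x < L j (y j)) ∧
      ∀ j ∈ I, j ∉ insert i J → L j x ≤ b j with hC
    have hCne : C.Nonempty := by
      obtain ⟨x, hxY, hxi, hxj⟩ := hx i hiI
      refine ⟨x, Finset.mem_filter.2 ⟨hxY, hxi, fun j hj => ?_, fun j hj hj' => ?_⟩⟩
      · exact (hxj j (hJ (Finset.mem_insert_of_mem hj)) (by rintro rfl; exact hi hj)).trans_lt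
          (h1 j hj).2
      · exact hxj j hj (by rintro rfl; exact hj' (Finset.mem_insert_self _ _))
    obtain ⟨z, hz, hzmin⟩ := Finset.exists_min_image C (L i) hCne
    obtain ⟨hzY, hzi, hzJ, hzI⟩ := Finset.mem_filter.1 hz
    have hyJ : ∀ j ∈ J, Function.update y i z j = y j := fun j hj =>
      Function.update_of_ne (by rintro rfl; exact hi hj) _ _
    have hyi : Function.update y i z i = z := Function.update_self ..
    refine ⟨Function.update y i z, ?_, ?_, ?_, ?_⟩
    · intro j hj
      rcases Finset.mem_insert.1 hj with rfl | hj
      · rw [hyi]; exact ⟨hzY, hzi⟩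
      · rw [hyJ j hj]; exact h1 j hj
    · intro j hj l hl hlj
      rcases Finset.mem_insert.1 hj with hj' | hj' <;> rcases Finset.mem_insert.1 hl with hl' | hl'
      · exact absurd (hl'.trans hj'.symm) hlj
      · rw [hj', hyi, hyJ l hl']; exact hzJ l hl'
      · rw [hl', hyi, hyJ j hj']; exact (h3 j hj' i hiI hi).trans_lt hzi
      · rw [hyJ j hj', hyJ l hl']; exact h2 j hj' l hl' hlj
    · intro j hj l hl hlJ
      rcases Finset.mem_insert.1 hj with rfl | hj
      · rw [hyi]; exact hzI l hl hlJ
      · rw [hyJ j hj]; exact h3 j hj l hl fun h => hlJ (Finset.mem_insert_of_mem h)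
    · intro x hxY hxJ hxI
      have hxJ' : ∀ j ∈ J, L j x < L j (y j) := fun j hj => by
        have := hxJ j (Finset.mem_insert_of_mem hj)
        rwa [hyJ j hj] at this
      have hxi := hxJ i (Finset.mem_insert_self _ _)
      rw [hyi] at hxi
      have hxb : L i x ≤ b i := by
        by_contra hcon
        have := hzmin x (Finset.mem_filter.2 ⟨hxY, not_le.1 hcon, hxJ', hxI⟩)
        linarith
      refine h4 x hxY hxJ' fun j hj hjJ => ?_
      by_cases hji : j = i
      · rw [hji]; exact hxb
      · exact hxI j hj fun h => (Finset.mem_insert.1 h).elim hji hjJ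

lemma convex_lt_or_eq {n : ℕ} (f : (Fin n → ℝ) →ₗ[ℝ] ℝ) (y : Fin n → ℝ) :
    Convex ℝ {z | f z < f y ∨ z = y} := by
  intro z hz w hw a b ha hb hab
  have key : ∀ z : Fin n → ℝ, (f z < f y ∨ z = y) → f z ≤ f y := by
    rintro z (h | rfl)
    · exact h.le
    · exact le_rfl
  have hz' := key z hz
  have hw' := key w hw
  have e : f (a • z + b • w) = a * f z + b * f w := by simp
  rcases ha.eq_or_lt with rfl | ha
  · obtain rfl : b = 1 := by linarith
    simpa using hw
  rcases hb.eq_or_lt with rfl | hb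
  · obtain rfl : a = 1 := by linarith
    simpa using hz
  rcases hz with hz | rfl
  · left
    rw [e]
    have : f y = a * f y + b * f y := by rw [← add_mul, hab, one_mul]
    nlinarith [mul_lt_mul_of_pos_left hz ha]
  rcases hw with hw | rfl
  · left
    rw [e]
    have : f z = a * f z + b * f z := by rw [← add_mul, hab, one_mul]
    nlinarith [mul_lt_mul_of_pos_left hw hb]
  · right
    rw [← add_smul, hab, one_smul]

lemma mem_integerPoints_submatrix {n m : ℕ} (A : Matrix (Fin m) (Fin n) ℝ) (b : Fin m → ℝ)
    (I : Finset (Fin m)) (x : Fin n → ℤ) :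
    x ∈ integerPoints (A.submatrix (fun i : I => (i : Fin m)) id) (fun i : I => b i) ↔
      ∀ i ∈ I, A.mulVec (toReal x) i ≤ b i := by
  constructor
  · intro h i hi
    exact h ⟨i, hi⟩
  · intro h i
    exact h i i.2

lemma ne_zero_of_mem_ellBounds {n k N : ℕ} (hN : N ∈ ellBounds n (k + 1)) : N ≠ 0 := by
  rintro rfl
  have := hN ∅ (fun _ x => absurd x.2 (Finset.notMem_empty _)) rfl
  simp [iconv] at this

/-- Given too many irredundant inequalities, the points provided by `exists_relaxation` are in
convex position, and all other lattice points of their convex hull are solutions. -/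
theorem sub_one_mem_helBounds {n k N : ℕ} (hN : N ∈ ellBounds n (k + 1)) :
    N - 1 ∈ helBounds n k := by
  classical
  have hN0 := ne_zero_of_mem_ellBounds hN
  intro m A b hk
  set P : Finset (Fin m) → Prop := fun I =>
    integerPoints (A.submatrix (fun i : I => (i : Fin m)) id) (fun i : I => b i) = integerPoints A b
  have hPiff : ∀ I, P I ↔ ∀ x, (∀ i ∈ I, A.mulVec (toReal x) i ≤ b i) → x ∈ integerPoints A b := by
    intro I
    constructor
    · intro h x hx
      have h' : _ = _ := h
      rw [← h', mem_integerPoints_submatrix]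
      exact hx
    · intro h
      ext x
      rw [mem_integerPoints_submatrix]
      exact ⟨h x, fun hx i _ => hx i⟩
  have huniv : P Finset.univ := (hPiff _).2 fun x hx i => hx i (Finset.mem_univ i)
  obtain ⟨I, hI, hImin⟩ := Finset.exists_min_image (Finset.univ.filter P) Finset.card
    ⟨_, Finset.mem_filter.2 ⟨Finset.mem_univ _, huniv⟩⟩
  have hPI := (Finset.mem_filter.1 hI).2
  refine ⟨I, ?_, hPI⟩
  by_contra hcard
  -- By minimality, every row of `I` is the only one violated by some integer point.
  have hviol : ∀ i ∈ I, ∃ x : Fin n → ℤ, b i < A.mulVec (toReal x) i ∧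
      ∀ j ∈ I, j ≠ i → A.mulVec (toReal x) j ≤ b j := by
    intro i hi
    by_contra hcon
    push Not at hcon
    have hPe : P (I.erase i) := by
      refine (hPiff _).2 fun x hx => (hPiff _).1 hPI x fun j hj => ?_
      by_cases hji : j = i
      · subst hji
        by_contra hlt
        obtain ⟨l, hl, hlj, hlt'⟩ := hcon x (not_le.1 hlt)
        exact absurd (hx l (Finset.mem_erase.2 ⟨hlj, hl⟩)) (not_le.2 hlt')
      · exact hx j (Finset.mem_erase.2 ⟨hji, hj⟩)
    have := hImin _ (Finset.mem_filter.2 ⟨Finset.mem_univ _, hPe⟩)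
    exact absurd (Finset.card_erase_lt_of_mem hi) (not_lt.2 this)
  have hSfin : (integerPoints A b).Finite :=
    Set.finite_of_encard_eq_coe hk
  choose! x hxi hxj using hviol
  set Y := (finite_iconv (hSfin.toFinset ∪ I.image x)).toFinset with hY
  have hYconv : ∀ z : Fin n → ℤ,
      toReal z ∈ convexHull ℝ (toReal '' (Y : Set (Fin n → ℤ))) → z ∈ Y := by
    intro z hz
    rw [hY, Set.Finite.mem_toFinset]
    refine convexHull_min ?_ (convex_convexHull ℝ _) hz
    rintro _ ⟨w, hw, rfl⟩
    rw [hY, Finset.mem_coe, Set.Finite.mem_toFinset] at hw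
    exact hw
  have hxY : ∀ i ∈ I, x i ∈ Y := by
    intro i hi
    rw [hY, Set.Finite.mem_toFinset]
    exact subset_convexHull ℝ _ ⟨x i, Finset.mem_coe.2 (Finset.mem_union_right _
      (Finset.mem_image_of_mem x hi)), rfl⟩
  obtain ⟨y, hy1, hy2, -, hy4⟩ := exists_relaxation Y (fun i z => A.mulVec (toReal z) i) b I
    (fun i hi => ⟨x i, hxY i hi, hxi i hi, hxj i hi⟩) I subset_rfl
  let f : Fin m → (Fin n → ℝ) →ₗ[ℝ] ℝ := fun i => (LinearMap.proj i).comp A.mulVecLin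
  have hf : ∀ i z, f i z = A.mulVec z i := fun i z => rfl
  simp only [← hf] at hy1 hy2 hy4
  obtain ⟨I', hI'I, hI'card⟩ := Finset.exists_subset_card_eq (show N ≤ I.card by omega)
  have hyinj : Set.InjOn y I' := by
    intro i hi j hj hij
    by_contra hne
    have := hy2 i (hI'I hi) j (hI'I hj) (Ne.symm hne)
    rw [hij] at this
    exact this.false
  set V := I'.image y with hV
  have hVcard : V.card = N := by rw [hV, Finset.card_image_of_injOn hyinj, hI'card]
  have hVpos : InConvexPosition V := by
    intro s v hv
    by_contra hvs
    obtain ⟨i, hi, hiv⟩ := Finset.mem_image.1 v.2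
    have hlt : (convexHull ℝ ((fun v : V => toReal (v : Fin n → ℤ)) '' s)) ⊆
        {z | f i z < f i (toReal (y i))} := by
      refine convexHull_min ?_ (convex_halfSpace_lt (f i).isLinear _)
      rintro _ ⟨w, hw, rfl⟩
      obtain ⟨j, hj, hjw⟩ := Finset.mem_image.1 w.2
      have hne : i ≠ j := by
        rintro rfl
        exact hvs (by rwa [show v = w from Subtype.ext (hiv.symm.trans hjw)])
      have := hy2 j (hI'I hj) i (hI'I hi) hne
      rw [hjw] at this
      exact this
    have h1 := hlt hv
    simp only [← hiv, Set.mem_ofPred_eq, lt_self_iff_false] at h1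
  have hsub : iconv V \ (V : Set (Fin n → ℤ)) ⊆ integerPoints A b := by
    rintro z ⟨hz, hzV⟩
    have hzY : z ∈ Y := by
      apply hYconv
      refine convexHull_mono (Set.image_mono ?_) hz
      intro w hw
      obtain ⟨i, hi, rfl⟩ := Finset.mem_image.1 (Finset.mem_coe.1 hw)
      exact (hy1 i (hI'I hi)).1
    refine (hPiff _).1 hPI z (hy4 z hzY ?_ fun j hj hj' => absurd hj hj')
    intro j hj
    by_cases hjI' : j ∈ I'
    · have hmem := convexHull_min (t := {w | f j w < f j (toReal (y j)) ∨ w = toReal (y j)}) (by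
        rintro _ ⟨w, hw, rfl⟩
        obtain ⟨i, hi, rfl⟩ := Finset.mem_image.1 (Finset.mem_coe.1 hw)
        by_cases hij : j = i
        · rw [hij]; exact Or.inr rfl
        · exact Or.inl (hy2 i (hI'I hi) j hj hij)) (convex_lt_or_eq _ _) hz
      refine hmem.resolve_right fun h => hzV ?_
      rw [toReal_injective h]
      exact Finset.mem_coe.2 (Finset.mem_image_of_mem y hjI')
    · exact convexHull_min (t := {w | f j w < f j (toReal (y j))}) (by
        rintro _ ⟨w, hw, rfl⟩
        obtain ⟨i, hi, rfl⟩ := Finset.mem_image.1 (Finset.mem_coe.1 hw)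
        exact hy2 i (hI'I hi) j hj (by rintro rfl; exact hjI' hi))
        (convex_halfSpace_lt (f j).isLinear _) hz
  have h1 := (hN V hVpos hVcard).trans (Set.encard_le_encard hsub)
  rw [hk] at h1
  have h2 : k + 1 ≤ k := by exact_mod_cast h1
  omega

/-! ### The numerical bound -/

lemma floor_add_one_mem_ellBounds (k : ℕ) :
    ⌊(4.43 : ℝ) * ((k : ℝ) + 4) ^ ((1 : ℝ) / 3)⌋₊ + 1 ∈ ellBounds 2 (k + 1) := by
  intro V hV hcard
  set t : ℝ := ((k : ℝ) + 4) ^ ((1 : ℝ) / 3) with ht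
  have ht3 : t ^ 3 = k + 4 := by
    rw [ht, ← Real.rpow_natCast, ← Real.rpow_mul (by positivity)]
    norm_num
  have ht0 : 0 ≤ t := by positivity
  have hk0 : (0 : ℝ) ≤ k := Nat.cast_nonneg k
  have ht1 : 1 ≤ t := by
    by_contra h
    have : t ^ 3 ≤ 1 := pow_le_one₀ ht0 (not_le.1 h).le
    linarith
  have hlt : 4.43 * t < V.card := by
    rw [hcard]; push_cast
    exact Nat.lt_floor_add_one _
  have h3 : 3 ≤ V.card := by
    have : (3 : ℝ) < V.card := by linarith
    exact_mod_cast this.le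
  have hmain := hV.card_pow_three_le h3
  by_contra hcon
  push Not at hcon
  have hVsub : (V : Set (Fin 2 → ℤ)) ⊆ iconv V := fun x hx => subset_convexHull ℝ _ ⟨x, hx, rfl⟩
  have hfin : (iconv V \ (V : Set (Fin 2 → ℤ))).Finite := (finite_iconv V).sdiff
  rw [← hfin.cast_ncard_eq] at hcon
  have hcon' : (iconv V \ (V : Set (Fin 2 → ℤ))).ncard < k + 1 := by exact_mod_cast hcon
  have hsum := Set.ncard_sdiff_add_ncard_of_subset hVsub (finite_iconv V)
  rw [Set.ncard_coe_finset] at hsum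
  have hle : ((iconv V).ncard : ℝ) ≤ k + V.card := by
    have : (iconv V).ncard ≤ k + V.card := by omega
    exact_mod_cast this
  set n : ℝ := (V.card : ℝ)
  have hn : 3 ≤ n := by linarith
  have hpi : Real.pi ^ 2 ≤ 9.87 := by
    have h1 := Real.pi_lt_d4
    have h2 := Real.pi_pos
    nlinarith
  have h1 : n ^ 3 ≤ 4 * 9.87 * (2 * k + n - 2) := by
    calc n ^ 3 ≤ _ := hmain
      _ ≤ 4 * Real.pi ^ 2 * (2 * k + n - 2) := by
        gcongr
        linarith
      _ ≤ _ := by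
        gcongr
        linarith
  have h2 : 86.9 * (k + 4) ≤ n ^ 3 := by
    calc 86.9 * ((k : ℝ) + 4) ≤ (4.43 * t) ^ 3 := by
          rw [mul_pow, ht3]
          nlinarith
      _ ≤ n ^ 3 := by gcongr
  -- The cubic that remains is positive; it is smallest near `n = 12`.
  nlinarith [mul_nonneg (sq_nonneg (n - 12)) (show 0 ≤ n + 24 by linarith)]

end QuantDoignon

theorem mainTheorem4 (k : ℕ) :
    IsLeast (QuantDoignon.helBounds 2 k) (QuantDoignon.c 2 k) ∧
    IsLeast (QuantDoignon.ellBounds 2 (k + 1)) (QuantDoignon.ell 2 (k + 1)) ∧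
    (QuantDoignon.c 2 k : ℤ) ≤ (QuantDoignon.ell 2 (k + 1) : ℤ) - 1 ∧
    (QuantDoignon.ell 2 (k + 1) : ℤ) - 1 ≤ ⌊(4.43 : ℝ) * ((k : ℝ) + 4) ^ ((1 : ℝ) / 3)⌋ := by
  have hmem := QuantDoignon.floor_add_one_mem_ellBounds k
  have hell : QuantDoignon.ell 2 (k + 1) ∈ QuantDoignon.ellBounds 2 (k + 1) :=
    Nat.sInf_mem ⟨_, hmem⟩
  have hhel := QuantDoignon.sub_one_mem_helBounds hell
  have hpos := QuantDoignon.ne_zero_of_mem_ellBounds hell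
  refine ⟨⟨Nat.sInf_mem ⟨_, hhel⟩, fun _ h => Nat.sInf_le h⟩, ⟨hell, fun _ h => Nat.sInf_le h⟩,
    ?_, ?_⟩
  · have : QuantDoignon.c 2 k ≤ QuantDoignon.ell 2 (k + 1) - 1 := Nat.sInf_le hhel
    omega
  · have h1 : QuantDoignon.ell 2 (k + 1) ≤ _ := Nat.sInf_le hmem
    rw [← Int.natCast_floor_eq_floor (by positivity)]
    omega
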